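/- Let $(\mathcal L,[\cdot_\lambda\cdot])$ be a Lie conformal algebra over $\mathbb C$ with a Nijenhuis operator, i.e. a $\mathbb C[\partial]$-linear map $\mathcal N:\mathcal L\to\mathcal L$ with $[\mathcal N(p)_\lambda\mathcal N(q)]=\mathcal N\big([p_\lambda q]_{\mathcal N}\big)$, where $[p_\lambda q]_{\mathcal N}=[\mathcal N(p)_\lambda q]+[p_\lambda\mathcal N(q)]-\mathcal N([p_\lambda q])$. Let $(\mathcal M,\rho,\mathcal N_{\mathcal M})$ be a Nijenhuis representation: $(\mathcal M,\rho)$ is a representation of $\mathcal L$ and $\mathcal N_{\mathcal M}:\mathcal M\to\mathcal M$ is $\mathbb C[\partial]$-linear with $$\rho(\mathcal N(p))_\lambda\mathcal N_{\mathcal M}(m)=\mathcal N_{\mathcal M}\Big(\rho(\mathcal N(p))_\lambda m+\rho(p)_\lambda\mathcal N_{\mathcal M}(m)-\mathcal N_{\mathcal M}(\rho(p)_\lambda m)\Big).$$ For $n\ge1$ let $C^n=C^n(\mathcal L,\mathcal M)$ be the space of $\mathbb C$-multilinear maps $f_{\lambda_1,\dots,\lambda_{n-1}}:\mathcal L^{n}\to\mathcal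 M[\lambda_1,\dots,\lambda_{n-1}]$ such that, with $\lambda_n:=-\partial-\lambda_1-\dots-\lambda_{n-1}$, one has $f(\dots,\partial p_i,\dots)=-\lambda_i f(\dots,p_i,\dots)$ for $1\le i\le n$, and $f$ is skew-symmetric under simultaneous permutations of the $p_i$ and the $\lambda_i$. Let $C^0=\mathcal M/\partial\mathcal M$. For a $\lambda$-bracket $b$ on $\mathcal L$, an action $B$ and $f\in C^n$, $n\ge1$, put $$D_{b,B}f(p_1,\dots,p_{n+1})=\sum_{i}(-1)^{i+1}B(p_i)_{\lambda_i}f_{\lambda_1,\dots,\widehat{\lambda_i},\dots,\lambda_n}(p_1,\dots,\widehat{p_i},\dots,p_{n+1})+\sum_{i<j}(-1)^{i+j}f_{\lambda_i+\lambda_j,\lambda_1,\dots,\widehat{\lambda_i},\dots,\widehat{\lambda_j},\dots,\lambda_n}(b(p_i,p_j)_{\lambda_i},p_1,\dots,\widehat{p_i},\dots,\widehat{p_j},\dots,p_{n+1}),$$ where $\lambda_{n+1}=-\partial-\lambda_1-\dots-\lambda_n$ and $f$ on $n$ arguments uses only the first $n-1$ of the parameters attached to them. Define $\delta=D_{[\cdot_\lambda\cdot],\rho}$,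 $d_{\mathcal N}=D_{[\cdot_\lambda\cdot]_{\mathcal N},\rho\circ\mathcal N}-\mathcal N_{\mathcal M}\circ\delta$, and on $C^0$ put $(\delta[m])(p)=\rho(p)_{-\partial}m$, $(d_{\mathcal N}[m])(p)=\rho(\mathcal N(p))_{-\partial}m-\mathcal N_{\mathcal M}(\rho(p)_{-\partial}m)$. Let $$(\xi^nf)(p_1,\dots,p_n)=\sum_{S\subseteq\{1,\dots,n\}}(-1)^{|S|}\mathcal N_{\mathcal M}^{|S|}f(q_1,\dots,q_n),\qquad q_i=p_i\ (i\in S),\quad q_i=\mathcal N(p_i)\ (i\notin S),$$ so that $\xi^0=\mathrm{id}$. Then: (1) The groups $C^1_{\mathcal NL}=C^1$ and $C^n_{\mathcal NL}=C^n\oplus C^{n-1}$ for $n\ge2$, with $d^1_{\mathcal NL}(f)=(\delta f,-\xi^1f)$ and $d^n_{\mathcal NL}(f,g)=(\delta f,(-1)^n\xi^nf+d_{\mathcal N}g)$ for $n\ge 2$, form a cochain complex: each $d^n_{\mathcal NL}$ is a well-defined linear map $C^n_{\mathcal NL}\to C^{n+1}_{\mathcal NL}$, and $d^{n+1}_{\mathcal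 NL}\circ d^n_{\mathcal NL}=0$ for all $n\ge1$. (2) The groups $C^0$ in degree $0$ and $C^n\oplus C^{n-1}$ in every degree $n\ge1$, with $c\mapsto(\delta c,\xi^0 c)$ in degree $0$ and $(f,g)\mapsto(\delta f,(-1)^n\xi^nf+d_{\mathcal N}g)$ in degree $n\ge1$, form a cochain complex in the same sense, with square zero for all $n\ge0$. In particular, both hold for the adjoint Nijenhuis representation $(\mathcal L,\mathrm{ad},\mathcal N)$, where $\mathrm{ad}(p)_\lambda q=[p_\lambda q]$. -/

import Mathlib

open scoped TensorProduct

namespace NijLCA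

universe u v

/-- The polynomial ring `ℂ[∂]`. -/
abbrev DRing : Type := Polynomial ℂ

/-- The polynomial ring `ℂ[∂][λ₁, …, λₖ]`. -/
abbrev LamRing (k : ℕ) : Type := MvPolynomial (Fin k) DRing

/-- For a `ℂ[∂]`-module `M`, the space `M[λ₁, …, λₖ]` of polynomials in `λ₁, …, λₖ` with
coefficients in `M`, as a module over `ℂ[∂][λ₁, …, λₖ]` (`∂` acts on the coefficients). -/
def LamPoly (k : ℕ) (M : Type v) [AddCommGroup M] [Module DRing M] : Type v :=
  LamRing k ⊗[DRing] M

section Instances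

variable {k : ℕ} {M : Type v} [AddCommGroup M] [Module DRing M]

noncomputable instance : AddCommGroup (LamPoly k M) :=
  inferInstanceAs (AddCommGroup (LamRing k ⊗[DRing] M))

noncomputable instance : Module (LamRing k) (LamPoly k M) :=
  inferInstanceAs (Module (LamRing k) (LamRing k ⊗[DRing] M))

noncomputable instance : Module DRing (LamPoly k M) :=
  inferInstanceAs (Module DRing (LamRing k ⊗[DRing] M))

noncomputable instance : Module ℂ (LamPoly k M) :=
  inferInstanceAs (Module ℂ (LamRing k ⊗[DRing] M))

instance : IsScalarTower DRing (LamRing k) (LamPoly k M) :=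
  inferInstanceAs (IsScalarTower DRing (LamRing k) (LamRing k ⊗[DRing] M))

instance : IsScalarTower ℂ (LamRing k) (LamPoly k M) :=
  inferInstanceAs (IsScalarTower ℂ (LamRing k) (LamRing k ⊗[DRing] M))

instance : IsScalarTower ℂ DRing (LamPoly k M) :=
  inferInstanceAs (IsScalarTower ℂ DRing (LamRing k ⊗[DRing] M))

end Instances

/-- `∂` as an element of `ℂ[∂][λ₁, …, λₖ]`. -/
noncomputable def del (k : ℕ) : LamRing k := MvPolynomial.C Polynomial.X

/-- The variable `λᵢ`. -/
noncomputable def lv {k : ℕ} (i : Fin k) : LamRing k := MvPolynomial.X i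

section Substitution

variable {A : Type u} [AddCommGroup A] [Module DRing A]
variable {M : Type v} [AddCommGroup M] [Module DRing M]

/-- The substitution `λᵢ ↦ μᵢ`, from `M[λ₁, …, λₖ]` to `M[λ₁, …, λₗ]`; the `μᵢ` may contain `∂`,
which acts on the coefficients. -/
noncomputable def subst {k l : ℕ} (μ : Fin k → LamRing l) :
    LamPoly k M →ₗ[DRing] LamPoly l M :=
  (LinearMap.rTensor M (MvPolynomial.aeval μ : LamRing k →ₐ[DRing] LamRing l).toLinearMap :
    LamRing k ⊗[DRing] M →ₗ[DRing] LamRing l ⊗[DRing] M)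

/-- The coefficients `mₐ ∈ M` of `∑ₐ λ₁^{a₁} ⋯ λₖ^{aₖ} mₐ`. -/
noncomputable def coeffs {k : ℕ} (v : LamPoly k M) : (Fin k →₀ ℕ) →₀ M :=
  TensorProduct.equivFinsuppOfBasisLeft (MvPolynomial.basisMonomials (Fin k) DRing) v

/-- `∑ₐ λ^a cₐ ↦ ∑ₐ μ^a F(cₐ)`: apply `F` to the coefficients and substitute `λᵢ ↦ μᵢ`. -/
noncomputable def evalWith {k l : ℕ} (μ : Fin k → LamRing l) (F : A → LamPoly l M)
    (v : LamPoly k A) : LamPoly l M :=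
  (coeffs v).sum fun a c => (∏ i, μ i ^ a i) • F c

theorem subst_smul {k l : ℕ} (μ : Fin k → LamRing l) (P : LamRing k) (v : LamPoly k M) :
    subst μ (P • v) = MvPolynomial.aeval μ P • subst μ v := by
  refine TensorProduct.induction_on (R := DRing) (M := LamRing k) (N := M)
    (motive := fun v => subst μ (P • (v : LamPoly k M)) =
      MvPolynomial.aeval μ P • subst μ (v : LamPoly k M)) v ?_ ?_ ?_
  · change subst μ (P • (0 : LamPoly k M)) = _ • subst μ (0 : LamPoly k M)
    rw [smul_zero, map_zero, smul_zero]
  · intro Q m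
    change (MvPolynomial.aeval μ (P * Q) : LamRing l) ⊗ₜ[DRing] m =
      (MvPolynomial.aeval μ P * MvPolynomial.aeval μ Q : LamRing l) ⊗ₜ[DRing] m
    rw [map_mul]
  · intro (x : LamPoly k M) (y : LamPoly k M) hx hy
    change subst μ (P • (x + y)) = _ • subst μ (x + y)
    rw [smul_add, map_add, map_add, smul_add]
    exact congrArg₂ (· + ·) hx hy

theorem subst_smul_complex {M : Type v} [AddCommGroup M] [Module DRing M]
    {k l : ℕ} (μ : Fin k → LamRing l) (c : ℂ) (v : LamPoly k M) :
    subst μ (c • v) = c • subst μ v := by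
  have h : ∀ (j : ℕ) (w : LamPoly j M), c • w = algebraMap ℂ (LamRing j) c • w :=
    fun j w => (algebraMap_smul (LamRing j) c w).symm
  rw [h, h, subst_smul]
  congr 1
  rw [IsScalarTower.algebraMap_apply ℂ DRing (LamRing k), AlgHom.commutes,
    ← IsScalarTower.algebraMap_apply]

end Substitution

section Algebra

variable {A : Type u} [AddCommGroup A] [Module DRing A]
variable {M : Type v} [AddCommGroup M] [Module DRing M]

/-- `B(p)_s v_{μ₁, …, μₖ}`, for a `λ`-action `B : A × M → M[λ]` and `v ∈ M[λ₁, …, λₖ]`: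
`B(p)_s` is applied to the coefficients of `v`. -/
noncomputable def opAct (B : A → M → LamPoly 1 M) {k l : ℕ} (p : A) (s : LamRing l)
    (μ : Fin k → LamRing l) (v : LamPoly k M) : LamPoly l M :=
  evalWith μ (fun m => subst ![s] (B p m)) v

/-- `B(w_s)_t m`, for a `λ`-action `B : A × M → M[λ]` and `w ∈ A[λ]`. -/
noncomputable def opComp (B : A → M → LamPoly 1 M) {l : ℕ} (w : LamPoly 1 A) (s t : LamRing l)
    (m : M) : LamPoly l M :=
  evalWith ![s] (fun c => subst ![t] (B c m)) w

end Algebra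

/-- Lie conformal algebras; `bracket p q` is `[p_λ q] ∈ L[λ]`. In the Jacobi identity
`λ = lv 0` and `μ = lv 1`. -/
class LieConformalAlgebra (L : Type u) [AddCommGroup L] [Module ℂ L] [Module DRing L]
    [IsScalarTower ℂ DRing L] where
  bracket : L →ₗ[ℂ] L →ₗ[ℂ] LamPoly 1 L
  del_left : ∀ p q : L, bracket ((Polynomial.X : DRing) • p) q = -((lv 0 : LamRing 1) • bracket p q)
  del_right : ∀ p q : L,
    bracket p ((Polynomial.X : DRing) • q) = (del 1 + lv 0) • bracket p q
  skew : ∀ p q : L, bracket p q = -subst ![-del 1 - lv 0] (bracket q p)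
  jacobi : ∀ p q r : L,
    opAct (fun a b => bracket a b) p (lv 0 : LamRing 2) ![lv 1] (bracket q r) =
      opComp (fun a b => bracket a b) (bracket p q) (lv 0 : LamRing 2) (lv 0 + lv 1) r +
        opAct (fun a b => bracket a b) q (lv 1 : LamRing 2) ![lv 0] (bracket p r)

/-- `[p_λ q]`. -/
noncomputable def br {L : Type u} [AddCommGroup L] [Module ℂ L] [Module DRing L]
    [IsScalarTower ℂ DRing L] [LieConformalAlgebra L] (p q : L) : LamPoly 1 L :=
  LieConformalAlgebra.bracket p q

/-- A representation of a Lie conformal algebra `L` on a `ℂ[∂]`-module `M`; `act p m` is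
`ρ(p)_λ m ∈ M[λ]`. -/
structure ConformalRep (L : Type u) [AddCommGroup L] [Module ℂ L] [Module DRing L]
    [IsScalarTower ℂ DRing L] [LieConformalAlgebra L]
    (M : Type v) [AddCommGroup M] [Module ℂ M] [Module DRing M] [IsScalarTower ℂ DRing M] where
  act : L →ₗ[ℂ] M →ₗ[ℂ] LamPoly 1 M
  del_left : ∀ (p : L) (m : M), act ((Polynomial.X : DRing) • p) m = -((lv 0 : LamRing 1) • act p m)
  del_right : ∀ (p : L) (m : M),
    act p ((Polynomial.X : DRing) • m) = (del 1 + lv 0) • act p m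
  comm : ∀ (p q : L) (m : M),
    opComp (fun a b => act a b) (br p q) (lv 0 : LamRing 2) (lv 0 + lv 1) m =
      opAct (fun a b => act a b) p (lv 0 : LamRing 2) ![lv 1] (act q m) -
        opAct (fun a b => act a b) q (lv 1 : LamRing 2) ![lv 0] (act p m)

section Main

variable {L : Type u} [AddCommGroup L] [Module ℂ L] [Module DRing L]
  [IsScalarTower ℂ DRing L]
variable {M : Type v} [AddCommGroup M] [Module ℂ M] [Module DRing M] [IsScalarTower ℂ DRing M]

/-- The adjoint representation `ad(p)_λ q = [p_λ q]`. -/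
noncomputable def adjoint (L : Type u) [AddCommGroup L] [Module ℂ L] [Module DRing L]
    [IsScalarTower ℂ DRing L] [LieConformalAlgebra L] : ConformalRep L L where
  act := LieConformalAlgebra.bracket
  del_left := LieConformalAlgebra.del_left
  del_right := LieConformalAlgebra.del_right
  comm p q r := by
    rw [LieConformalAlgebra.jacobi p q r, add_sub_cancel_right]; rfl

/-- The coefficientwise extension of a `ℂ[∂]`-linear map to `M[λ₁, …, λₖ]`. -/
noncomputable def ext (k : ℕ) (T : M →ₗ[DRing] M) : LamPoly k M →ₗ[DRing] LamPoly k M :=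
  (LinearMap.lTensor (LamRing k) T : LamRing k ⊗[DRing] M →ₗ[DRing] LamRing k ⊗[DRing] M)

/-- `N` is a Nijenhuis operator on the Lie conformal algebra `L`. -/
def IsNijenhuis [LieConformalAlgebra L] (N : L →ₗ[DRing] L) : Prop :=
  ∀ p q : L, br (N p) (N q) = ext 1 N (br (N p) q + br p (N q) - ext 1 N (br p q))

/-- `(M, ρ, N_M)` is a Nijenhuis representation of `(L, N)`. -/
def IsNijenhuisRep [LieConformalAlgebra L] (N : L →ₗ[DRing] L) (ρ : ConformalRep L M)
    (NM : M →ₗ[DRing] M) : Prop :=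
  ∀ (p : L) (m : M), ρ.act (N p) (NM m) =
    ext 1 NM (ρ.act (N p) m + ρ.act p (NM m) - ext 1 NM (ρ.act p m))

/-- The deformed bracket `[p_λ q]_N = [N(p)_λ q] + [p_λ N(q)] - N([p_λ q])`. -/
noncomputable def brN [LieConformalAlgebra L] (N : L →ₗ[DRing] L) (p q : L) : LamPoly 1 L :=
  br (N p) q + br p (N q) - ext 1 N (br p q)

/-- The subspace `∂M` of `M`. -/
noncomputable def delRange (M : Type v) [AddCommGroup M] [Module ℂ M] [Module DRing M]
    [IsScalarTower ℂ DRing M] : Submodule ℂ M :=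
  LinearMap.range ((LinearMap.lsmul DRing M Polynomial.X).restrictScalars ℂ)

/-- Where `n`-cochains take their values: `M / ∂M` for `n = 0`, and `M[λ₁, …, λₙ₋₁]` for
`n ≥ 1`. -/
def CochVal (M : Type v) [AddCommGroup M] [Module ℂ M] [Module DRing M]
    [IsScalarTower ℂ DRing M] : ℕ → Type v
  | 0 => M ⧸ delRange M
  | k + 1 => LamPoly k M

noncomputable instance : ∀ n, AddCommGroup (CochVal M n)
  | 0 => inferInstanceAs (AddCommGroup (M ⧸ delRange M))
  | k + 1 => inferInstanceAs (AddCommGroup (LamPoly k M))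

noncomputable instance : ∀ n, Module ℂ (CochVal M n)
  | 0 => inferInstanceAs (Module ℂ (M ⧸ delRange M))
  | k + 1 => inferInstanceAs (Module ℂ (LamPoly k M))

/-- All functions of `n` arguments in `L` with values in the value space of `n`-cochains. -/
abbrev RawCochain (L : Type u) (M : Type v) [AddCommGroup M] [Module ℂ M] [Module DRing M]
    [IsScalarTower ℂ DRing M] (n : ℕ) : Type (max u v) :=
  (Fin n → L) → CochVal M n

/-- The sequence `λ₁, …, λₖ, λₖ₊₁` in `ℂ[∂][λ₁, …, λₖ]`, where the last entry stands for
`-∂ - λ₁ - ⋯ - λₖ`. -/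
noncomputable def lam (k : ℕ) : Fin (k + 1) → LamRing k :=
  Fin.snoc (fun i => lv i) (-del k - ∑ i, lv i)

/-- `f_{μ₁, …, μₖ}(p₁, …, pₖ₊₁)`, for a sequence `μ₁, …, μₖ₊₁` whose last entry is not used. -/
noncomputable def evalAt {k l : ℕ} (f : (Fin (k + 1) → L) → LamPoly k M)
    (μ : Fin (k + 1) → LamRing l) (p : Fin (k + 1) → L) : LamPoly l M :=
  subst (fun a : Fin k => μ a.castSucc) (f p)

/-- `ℂ`-multilinearity, conformal sesquilinearity (`f(…, ∂pᵢ, …) = -λᵢ f(…, pᵢ, …)`, which for the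
last argument reads `f(…, ∂pₙ) = (∂ + λ₁ + ⋯ + λₙ₋₁) f(…, pₙ)`) and conformal skew-symmetry
(invariance up to sign under simultaneous permutation of the `pᵢ` and the `λᵢ`, with
`λₙ = -∂ - λ₁ - ⋯ - λₙ₋₁`). -/
structure IsCochain {k : ℕ} (f : (Fin (k + 1) → L) → LamPoly k M) : Prop where
  map_add : ∀ (p : Fin (k + 1) → L) (i : Fin (k + 1)) (x y : L),
    f (Function.update p i (x + y)) = f (Function.update p i x) + f (Function.update p i y)
  map_smul : ∀ (p : Fin (k + 1) → L) (i : Fin (k + 1)) (c : ℂ) (x : L),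
    f (Function.update p i (c • x)) = c • f (Function.update p i x)
  sesq : ∀ (p : Fin (k + 1) → L) (i : Fin (k + 1)),
    f (Function.update p i ((Polynomial.X : DRing) • p i)) = -(lam k i • f p)
  skew : ∀ (τ : Equiv.Perm (Fin (k + 1))) (p : Fin (k + 1) → L),
    evalAt f (lam k ∘ τ) (p ∘ τ) = ((Equiv.Perm.sign τ : ℤˣ) : ℤ) • f p

/-- The space `Cⁿ(L, M)` of `n`-cochains. -/
noncomputable def cochains (L : Type u) [AddCommGroup L] [Module ℂ L] [Module DRing L]
    (M : Type v) [AddCommGroup M] [Module ℂ M] [Module DRing M] [IsScalarTower ℂ DRing M] :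
    ∀ n, Submodule ℂ (RawCochain L M n)
  | 0 => ⊤
  | k + 1 =>
    let C : Submodule ℂ ((Fin (k + 1) → L) → LamPoly k M) :=
      { carrier := {f | IsCochain f}
        zero_mem' := by
          constructor <;> intros <;> simp [evalAt]
        add_mem' := by
          intro f g hf hg
          constructor
          · intro p i x y
            simp only [Pi.add_apply, hf.map_add, hg.map_add]; abel
          · intro p i c x
            simp only [Pi.add_apply, hf.map_smul, hg.map_smul, smul_add]
          · intro p i
            simp only [Pi.add_apply, hf.sesq, hg.sesq, smul_add, neg_add]
          · intro τ p
            have h1 := hf.skew τ p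
            have h2 := hg.skew τ p
            simp only [evalAt] at h1 h2
            simp only [evalAt, Pi.add_apply, map_add, smul_add, h1, h2]
        smul_mem' := by
          intro c f hf
          constructor
          · intro p i x y
            simp only [Pi.smul_apply, hf.map_add, smul_add]
          · intro p i d x
            simp only [Pi.smul_apply, hf.map_smul, smul_comm c d]
          · intro p i
            simp only [Pi.smul_apply, hf.sesq, smul_neg, smul_comm c (lam k i)]
          · intro τ p
            have h1 := hf.skew τ p
            simp only [evalAt] at h1
            simp only [evalAt, Pi.smul_apply, subst_smul_complex, h1]
            rw [smul_comm] }
    C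

section Operators

variable [LieConformalAlgebra L]

/-- `[m] ↦ ρ(p)_{-∂} m`, from `M / ∂M` to `M`. -/
noncomputable def actZero (ρ : ConformalRep L M) (p : L) :
    (M ⧸ delRange M) →ₗ[ℂ] LamPoly 0 M :=
  (delRange M).liftQ
    { toFun := fun m => subst ![-del 0] (ρ.act p m)
      map_add' := fun m m' => by rw [map_add, map_add]
      map_smul' := fun c m => by rw [map_smul, subst_smul_complex]; rfl }
    (by
      rintro _ ⟨m, rfl⟩
      change subst ![-del 0] (ρ.act p ((Polynomial.X : DRing) • m)) = 0
      rw [ρ.del_right, subst_smul]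
      simp [del, lv])

/-- The Chevalley–Eilenberg type expression, for a bracket `b : L × L → L[λ]`, a `λ`-action
`B : L × M → M[λ]`, and `n = k + 1`:
`∑ᵢ (-1)^{i+1} B(pᵢ)_{λᵢ} f_{λ₁, …, λ̂ᵢ, …, λₙ}(p₁, …, p̂ᵢ, …, pₙ₊₁)
 + ∑_{i<j} (-1)^{i+j} f_{λᵢ+λⱼ, λ₁, …, λ̂ᵢ, …, λ̂ⱼ, …, λₙ}(b(pᵢ, pⱼ)_{λᵢ}, p₁, …, p̂ᵢ, …, p̂ⱼ, …, pₙ₊₁)`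
with `λₙ₊₁ = -∂ - λ₁ - ⋯ - λₙ`. Indices start at `0` here; in the second sum a pair `i < j` is
given by `j : Fin (k + 2)` and `i : Fin (k + 1)` with `i.castSucc < j`, and then
`fun a => j.succAbove (i.succAbove a)` lists the remaining indices in increasing order. -/
noncomputable def ceSum (b : L → L → LamPoly 1 L) (B : L → M → LamPoly 1 M) {k : ℕ}
    (f : (Fin (k + 1) → L) → LamPoly k M) (p : Fin (k + 2) → L) : LamPoly (k + 1) M :=
  (∑ i : Fin (k + 2), (-1 : ℤ) ^ (i : ℕ) •
      opAct B (p i) (lam (k + 1) i) (fun a : Fin k => lam (k + 1) (i.succAbove a.castSucc))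
        (f fun a => p (i.succAbove a))) +
    ∑ j : Fin (k + 2), ∑ i : Fin (k + 1),
      if i.castSucc < j then
        (-1 : ℤ) ^ ((i : ℕ) + (j : ℕ)) •
          evalWith ![lam (k + 1) i.castSucc]
            (fun c => evalAt f
              (Fin.cons (lam (k + 1) i.castSucc + lam (k + 1) j)
                fun a => lam (k + 1) (j.succAbove (i.succAbove a)))
              (Fin.cons c fun a => p (j.succAbove (i.succAbove a))))
            (b (p i.castSucc) (p j))
      else 0

/-- The coboundary `δ` of the Lie conformal algebra `L` with coefficients in `(M, ρ)`; on
`0`-cochains `(δ[m])(p) = ρ(p)_{-∂} m`. -/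
noncomputable def rawDelta (ρ : ConformalRep L M) :
    ∀ n, RawCochain L M n → RawCochain L M (n + 1)
  | 0, f => fun p => actZero ρ (p 0) (f Fin.elim0)
  | k + 1, f => ceSum (k := k) br (fun p m => ρ.act p m) f

/-- The coboundary `d_{N, M}` of the Nijenhuis operator; on `0`-cochains
`(d[m])(p) = ρ(N p)_{-∂} m - N_M(ρ(p)_{-∂} m)`. -/
noncomputable def rawDN (N : L →ₗ[DRing] L) (ρ : ConformalRep L M) (NM : M →ₗ[DRing] M) :
    ∀ n, RawCochain L M n → RawCochain L M (n + 1)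
  | 0, f => fun p =>
      (actZero ρ (N (p 0)) (f Fin.elim0) - ext 0 NM (actZero ρ (p 0) (f Fin.elim0)) : LamPoly 0 M)
  | k + 1, f => fun p =>
      (ceSum (k := k) (brN N) (fun q m => ρ.act (N q) m) f p -
        ext (k + 1) NM (ceSum (k := k) br (fun q m => ρ.act q m) f p) : LamPoly (k + 1) M)

/-- The map `ξⁿ`:
`(ξⁿ f)(p₁, …, pₙ) = ∑_{S ⊆ {1, …, n}} (-1)^{|S|} N_M^{|S|}(f(q₁, …, qₙ))`, where `qᵢ = pᵢ` for
`i ∈ S` and `qᵢ = N(pᵢ)` for `i ∉ S`. -/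
noncomputable def rawXi (N : L →ₗ[DRing] L) (NM : M →ₗ[DRing] M) :
    ∀ n, RawCochain L M n → RawCochain L M n
  | 0, f => f
  | k + 1, f => fun p =>
      (∑ S : Finset (Fin (k + 1)), (-1 : ℤ) ^ S.card •
        ext k (NM ^ S.card) (f fun i => if i ∈ S then p i else N (p i)) : LamPoly k M)

/-- The map `d_{NL}`: `(f, g) ↦ (δⁿ f, (-1)ⁿ ξⁿ f + d_N^{n-1} g)`; for `n = 0` there is no
component `g`, and `f ↦ (δ⁰ f, ξ⁰ f)`. -/
noncomputable def rawDNL (N : L →ₗ[DRing] L) (ρ : ConformalRep L M) (NM : M →ₗ[DRing] M) :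
    ∀ n, RawCochain L M n × RawCochain L M (n - 1) → RawCochain L M (n + 1) × RawCochain L M n
  | 0, x => (rawDelta ρ 0 x.1, rawXi N NM 0 x.1)
  | n + 1, x => (rawDelta ρ (n + 1) x.1,
      (-1 : ℤ) ^ (n + 1) • rawXi N NM (n + 1) x.1 + rawDN N ρ NM n x.2)

end Operators

/-- The combined cochain groups in degrees `≥ 1`; the degree is `n + 1`. They are
`C¹(L, M)` in degree `1` and `Cⁿ(L, M) ⊕ C_N^{n-1}(L, M)` in degree `n ≥ 2`. -/
noncomputable def nlCochains (L : Type u) [AddCommGroup L] [Module ℂ L] [Module DRing L]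
    (M : Type v) [AddCommGroup M] [Module ℂ M] [Module DRing M] [IsScalarTower ℂ DRing M] :
    ∀ n, Submodule ℂ (RawCochain L M (n + 1) × RawCochain L M n)
  | 0 => (cochains L M 1).prod ⊥
  | n + 1 => (cochains L M (n + 2)).prod (cochains L M (n + 1))

/-- The combined cochain groups with degree `0` included: `C⁰(L, M)` in degree `0` and
`Cⁿ(L, M) ⊕ C_N^{n-1}(L, M)` in every degree `n ≥ 1`, where `C_N⁰ = C⁰`. -/
noncomputable def nlCochainsFull (L : Type u) [AddCommGroup L] [Module ℂ L] [Module DRing L]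
    (M : Type v) [AddCommGroup M] [Module ℂ M] [Module DRing M] [IsScalarTower ℂ DRing M] :
    ∀ n, Submodule ℂ (RawCochain L M n × RawCochain L M (n - 1))
  | 0 => (cochains L M 0).prod ⊥
  | n + 1 => (cochains L M (n + 1)).prod (cochains L M n)

end Main

/-- The maps `D n` restrict to `ℂ`-linear maps `G n → G (n + 1)` between the given subspaces, and
these form a cochain complex. -/
def FormsCochainComplex {A : ℕ → Type v} [∀ n, AddCommGroup (A n)] [∀ n, Module ℂ (A n)]
    (G : ∀ n, Submodule ℂ (A n)) (D : ∀ n, A n → A (n + 1)) : Prop :=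
  ∃ d : ∀ n, G n →ₗ[ℂ] G (n + 1),
    (∀ (n : ℕ) (x : G n), (d n x : A (n + 1)) = D n x) ∧
      ∀ n : ℕ, d (n + 1) ∘ₗ d n = 0

end NijLCA

/-!
A commutative `ℂ`-algebra `R` turns a `ℂ[∂]`-module `M` into an `R`-module `CurrentModule R M`, and
turns a `λ`-action into an `R`-bilinear map: the value on the generators `p`, `m` in the summands of
index `s`, `t` is `p_λ m` at `λ = s`, in the summand of index `s + t`. In this way a Lie conformal
algebra becomes a Lie algebra over `R`, a representation becomes a Lie algebra representation,
Nijenhuis operators become Nijenhuis operators, and an `n`-cochain `f` becomes the alternating map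
whose value on generators `pᵢ` of index `sᵢ` is `f(p₁, …, pₙ)` at `λᵢ = sᵢ`; sesquilinearity, also
in the last variable `λₙ = -∂ - λ₁ - ⋯ - λₙ₋₁`, becomes part of `R`-multilinearity. For
`R = ℂ[∂][λ₁, …, λₙ₋₁]` and `sᵢ = λᵢ` nothing is lost, so it is enough to prove the identities
`δ² = 0`, `d_N² = 0` and `ξδ = d_N ξ` for alternating maps, where they follow from Cartan calculus
by induction on the degree: a form is determined by its contractions `ι_x`, and
`ι_x δ + δ ι_x = L_x`.
-/

namespace NijLCA

universe u v

section CartanCalculus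

open AlternatingMap (alternatizeUncurryFin alternatizeUncurryFinLM)

variable {R V W : Type*} [CommRing R] [AddCommGroup V] [Module R V] [AddCommGroup W] [Module R W]
variable {n : ℕ}

/-- The interior product `ι_x F = F(x, …)` of a vector with an alternating map, linear in both
arguments. -/
def interior : V →ₗ[R] (V [⋀^Fin (n + 1)]→ₗ[R] W) →ₗ[R] V [⋀^Fin n]→ₗ[R] W :=
  AlternatingMap.curryLeftLinearMap.flip

theorem interior_apply (x : V) (F : V [⋀^Fin (n + 1)]→ₗ[R] W) (v : Fin n → V) :
    interior x F v = F (Fin.cons x v) :=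
  rfl

theorem ext_interior {F G : V [⋀^Fin (n + 1)]→ₗ[R] W}
    (h : ∀ x, interior x F = interior x G) : F = G := by
  ext v
  simpa only [interior_apply, Fin.cons_self_tail] using
    DFunLike.congr_fun (h (v 0)) (Fin.tail v)

theorem interior_interior_swap (x y : V) (F : V [⋀^Fin (n + 2)]→ₗ[R] W) :
    interior x (interior y F) = -interior y (interior x F) := by
  have h (z : V) : interior z (interior z F) = 0 := F.curryLeft_same z
  have hxy := h (x + y)
  simp only [map_add, LinearMap.add_apply, h, zero_add, add_zero] at hxy
  exact eq_neg_of_add_eq_zero_right hxy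

theorem interior_alternatizeUncurryFin_zero (Φ : V →ₗ[R] V [⋀^Fin 0]→ₗ[R] W) (x : V) :
    interior x (alternatizeUncurryFin Φ) = Φ x := by
  ext v
  simp [interior_apply, AlternatingMap.alternatizeUncurryFin_apply, Fin.removeNth_zero]

theorem interior_alternatizeUncurryFin (Φ : V →ₗ[R] V [⋀^Fin (n + 1)]→ₗ[R] W) (x : V) :
    interior x (alternatizeUncurryFin Φ) =
      Φ x - alternatizeUncurryFin (interior x ∘ₗ Φ) := by
  ext v
  have removeNth_succ_cons (j : Fin (n + 1)) : j.succ.removeNth (Fin.cons x v : Fin (n + 2) → V) =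
      (Fin.cons x (j.removeNth v) : Fin (n + 1) → V) :=
    funext (Fin.cases rfl fun _ => by simp [Fin.removeNth])
  rw [interior_apply, AlternatingMap.alternatizeUncurryFin_apply, Fin.sum_univ_succ,
    AlternatingMap.sub_apply, AlternatingMap.alternatizeUncurryFin_apply, sub_eq_add_neg,
    ← Finset.sum_neg_distrib]
  simp [removeNth_succ_cons, interior_apply, pow_succ, Fin.removeNth_zero]

/-- Composition of alternating maps with a linear map on the values, linear in both arguments. -/
def postcomp : (W →ₗ[R] W) →ₗ[R] (V [⋀^Fin n]→ₗ[R] W) →ₗ[R] V [⋀^Fin n]→ₗ[R] W :=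
  LinearMap.mk₂ R LinearMap.compAlternatingMap (fun _ _ _ => rfl) (fun _ _ _ => rfl)
    (fun T F G => by ext; simp) fun c T F => by ext; simp

@[simp] theorem postcomp_apply (T : W →ₗ[R] W) (F : V [⋀^Fin n]→ₗ[R] W) (v : Fin n → V) :
    postcomp T F v = T (F v) :=
  rfl

theorem interior_postcomp (T : W →ₗ[R] W) (x : V) (F : V [⋀^Fin (n + 1)]→ₗ[R] W) :
    interior x (postcomp T F) = postcomp T (interior x F) :=
  rfl

theorem alternatizeUncurryFin_postcomp (T : W →ₗ[R] W) (Φ : V →ₗ[R] V [⋀^Fin n]→ₗ[R] W) :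
    alternatizeUncurryFin (postcomp T ∘ₗ Φ) = postcomp T (alternatizeUncurryFin Φ) := by
  ext v
  simp [AlternatingMap.alternatizeUncurryFin_apply]

/-- The action of an endomorphism `T` of `V` on alternating maps as a derivation: the sum over all
arguments of the maps obtained by applying `T` to that argument. Linear in both arguments. -/
def der : ∀ {n : ℕ}, (V →ₗ[R] V) →ₗ[R] (V [⋀^Fin n]→ₗ[R] W) →ₗ[R] V [⋀^Fin n]→ₗ[R] W
  | 0 => 0
  | _ + 1 => LinearMap.mk₂ R (fun T F => alternatizeUncurryFin (F.curryLeft ∘ₗ T))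
      (fun S T F => by rw [LinearMap.comp_add, AlternatingMap.alternatizeUncurryFin_add])
      (fun c T F => by rw [LinearMap.comp_smul, AlternatingMap.alternatizeUncurryFin_smul])
      (fun T F G => by rw [AlternatingMap.curryLeft_add, LinearMap.add_comp,
        AlternatingMap.alternatizeUncurryFin_add])
      (fun c T F => by rw [AlternatingMap.curryLeft_smul, LinearMap.smul_comp,
        AlternatingMap.alternatizeUncurryFin_smul])

theorem der_zero_degree (T : V →ₗ[R] V) (F : V [⋀^Fin 0]→ₗ[R] W) : der T F = 0 :=
  rfl

theorem der_succ_degree (T : V →ₗ[R] V) (F : V [⋀^Fin (n + 1)]→ₗ[R] W) :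
    der T F = alternatizeUncurryFin (F.curryLeft ∘ₗ T) :=
  rfl

theorem interior_der (T : V →ₗ[R] V) (x : V) (F : V [⋀^Fin (n + 1)]→ₗ[R] W) :
    interior x (der T F) = der T (interior x F) + interior (T x) F := by
  cases n with
  | zero =>
    rw [der_succ_degree, interior_alternatizeUncurryFin_zero, der_zero_degree, zero_add]
    rfl
  | succ n =>
    have h : interior x ∘ₗ (F.curryLeft ∘ₗ T) = -((interior x F).curryLeft ∘ₗ T) :=
      LinearMap.ext fun y => interior_interior_swap x (T y) F
    rw [der_succ_degree, interior_alternatizeUncurryFin, h, ← neg_one_smul R,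
      AlternatingMap.alternatizeUncurryFin_smul, neg_one_smul, sub_neg_eq_add]
    exact add_comm _ _

theorem der_postcomp (T : V →ₗ[R] V) (S : W →ₗ[R] W) (F : V [⋀^Fin n]→ₗ[R] W) :
    der T (postcomp S F) = postcomp S (der T F) := by
  cases n with
  | zero => rw [der_zero_degree, der_zero_degree, map_zero]
  | succ n => exact alternatizeUncurryFin_postcomp S (F.curryLeft ∘ₗ T)

/-- The Lie derivative `L_x`, for a bracket `b` and an action `B`, linear in `x`. -/
def lieDeriv (b : V →ₗ[R] V →ₗ[R] V) (B : V →ₗ[R] W →ₗ[R] W) :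
    V →ₗ[R] (V [⋀^Fin n]→ₗ[R] W) →ₗ[R] V [⋀^Fin n]→ₗ[R] W :=
  postcomp ∘ₗ B - der ∘ₗ b

variable (b b' : V →ₗ[R] V →ₗ[R] V) (B B' : V →ₗ[R] W →ₗ[R] W)

theorem lieDeriv_apply (x : V) (F : V [⋀^Fin n]→ₗ[R] W) :
    lieDeriv b B x F = postcomp (B x) F - der (b x) F :=
  rfl

theorem lieDeriv_zero_degree (x : V) (F : V [⋀^Fin 0]→ₗ[R] W) :
    lieDeriv b B x F = postcomp (B x) F := by
  rw [lieDeriv_apply, der_zero_degree, sub_zero]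

theorem interior_lieDeriv (x y : V) (F : V [⋀^Fin (n + 1)]→ₗ[R] W) :
    interior y (lieDeriv b B x F) = lieDeriv b B x (interior y F) - interior (b x y) F := by
  rw [lieDeriv_apply, map_sub, interior_postcomp, interior_der, lieDeriv_apply, sub_add_eq_sub_sub]

variable [Invertible (2 : R)]

/-- The Chevalley–Eilenberg differential, for a skew-symmetric bracket `b` and an action `B`. It
is written as the alternatization of a Lie derivative; the bracket is halved because every pair of
arguments is met twice. -/
def chevalleyEilenberg : (V [⋀^Fin n]→ₗ[R] W) →ₗ[R] V [⋀^Fin (n + 1)]→ₗ[R] W :=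
  alternatizeUncurryFinLM ∘ₗ (lieDeriv ((⅟2 : R) • b) B).flip

theorem chevalleyEilenberg_apply (F : V [⋀^Fin n]→ₗ[R] W) :
    chevalleyEilenberg b B F =
      alternatizeUncurryFin ((lieDeriv ((⅟2 : R) • b) B).flip F) :=
  rfl

theorem chevalleyEilenberg_add_left :
    chevalleyEilenberg (n := n) (b + b') (B + B') =
      chevalleyEilenberg b B + chevalleyEilenberg b' B' := by
  have h : lieDeriv (n := n) ((⅟2 : R) • (b + b')) (B + B') =
      lieDeriv ((⅟2 : R) • b) B + lieDeriv ((⅟2 : R) • b') B' := by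
    simp only [lieDeriv, smul_add, LinearMap.comp_add]
    abel
  rw [chevalleyEilenberg, h, chevalleyEilenberg, chevalleyEilenberg, ← LinearMap.comp_add]
  rfl

theorem interior_chevalleyEilenberg_zero (x : V) (F : V [⋀^Fin 0]→ₗ[R] W) :
    interior x (chevalleyEilenberg b B F) = lieDeriv b B x F := by
  rw [chevalleyEilenberg_apply, interior_alternatizeUncurryFin_zero, LinearMap.flip_apply,
    lieDeriv_zero_degree, lieDeriv_zero_degree]

theorem chevalleyEilenberg_apply_zero (F : V [⋀^Fin 0]→ₗ[R] W) (v : Fin 1 → V) :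
    chevalleyEilenberg b B F v = B (v 0) (F (Fin.tail v)) := by
  rw [← postcomp_apply, ← lieDeriv_zero_degree b, ← interior_chevalleyEilenberg_zero,
    interior_apply, Fin.cons_self_tail]

variable {b}

theorem interior_chevalleyEilenberg (hb : ∀ x y, b x y = -b y x) (x : V)
    (F : V [⋀^Fin (n + 1)]→ₗ[R] W) :
    interior x (chevalleyEilenberg b B F) =
      lieDeriv b B x F - chevalleyEilenberg b B (interior x F) := by
  have h : interior x ∘ₗ (lieDeriv ((⅟2 : R) • b) B).flip F =
      (lieDeriv ((⅟2 : R) • b) B).flip (interior x F) + (⅟2 : R) • (F.curryLeft ∘ₗ b x) := by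
    ext1 y
    simp only [LinearMap.comp_apply, LinearMap.flip_apply, LinearMap.add_apply,
      interior_lieDeriv, LinearMap.smul_apply, hb y x, map_smul, map_neg, smul_neg,
      LinearMap.neg_apply, sub_neg_eq_add]
    rfl
  rw [chevalleyEilenberg_apply, interior_alternatizeUncurryFin, h,
    AlternatingMap.alternatizeUncurryFin_add, AlternatingMap.alternatizeUncurryFin_smul,
    ← der_succ_degree, ← chevalleyEilenberg_apply, LinearMap.flip_apply, lieDeriv_apply,
    lieDeriv_apply, LinearMap.smul_apply, map_smul, LinearMap.smul_apply]
  nth_rw 3 [← invOf_two_smul_add_invOf_two_smul R (der (b x) F)]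
  abel

end CartanCalculus

section LieRep

variable {R V W : Type*} [CommRing R] [AddCommGroup V] [Module R V] [AddCommGroup W] [Module R W]
variable {n : ℕ}

/-- `b` is a Lie bracket on `V` and `B` is a representation of it on `W`. Skew-symmetry is used in
place of `b x x = 0`, which is equivalent to it as `2` will be invertible. -/
structure IsLieRep (b : V →ₗ[R] V →ₗ[R] V) (B : V →ₗ[R] W →ₗ[R] W) : Prop where
  skew : ∀ x y, b x y = -b y x
  jacobi : ∀ x y z, b (b x y) z = b x (b y z) - b y (b x z)
  rep : ∀ x y w, B (b x y) w = B x (B y w) - B y (B x w)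

namespace IsLieRep

variable {b : V →ₗ[R] V →ₗ[R] V} {B : V →ₗ[R] W →ₗ[R] W}

theorem lieDeriv_lieDeriv_sub (h : IsLieRep b B) (x y : V) (F : V [⋀^Fin n]→ₗ[R] W) :
    lieDeriv b B x (lieDeriv b B y F) - lieDeriv b B y (lieDeriv b B x F) =
      lieDeriv b B (b x y) F := by
  induction n with
  | zero =>
    simp only [lieDeriv_zero_degree]
    ext v
    exact (h.rep x y (F v)).symm
  | succ n ih =>
    refine ext_interior fun z => ?_
    simp only [map_sub, interior_lieDeriv, ← ih, h.jacobi, LinearMap.sub_apply]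
    abel

variable [Invertible (2 : R)]

theorem lieDeriv_chevalleyEilenberg (h : IsLieRep b B) (x : V) (F : V [⋀^Fin n]→ₗ[R] W) :
    lieDeriv b B x (chevalleyEilenberg b B F) = chevalleyEilenberg b B (lieDeriv b B x F) := by
  induction n with
  | zero =>
    refine ext_interior fun y => ?_
    simp only [interior_lieDeriv, interior_chevalleyEilenberg_zero,
      ← h.lieDeriv_lieDeriv_sub x y F, sub_sub_cancel]
  | succ n ih =>
    refine ext_interior fun y => ?_
    simp only [interior_lieDeriv, interior_chevalleyEilenberg B h.skew,
      ← h.lieDeriv_lieDeriv_sub x y F, map_sub, ih]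
    abel

theorem chevalleyEilenberg_chevalleyEilenberg (h : IsLieRep b B) (F : V [⋀^Fin n]→ₗ[R] W) :
    chevalleyEilenberg b B (chevalleyEilenberg b B F) = 0 := by
  induction n with
  | zero =>
    refine ext_interior fun x => ?_
    rw [interior_chevalleyEilenberg B h.skew, interior_chevalleyEilenberg_zero,
      h.lieDeriv_chevalleyEilenberg, sub_self, map_zero]
  | succ n ih =>
    refine ext_interior fun x => ?_
    rw [interior_chevalleyEilenberg B h.skew, interior_chevalleyEilenberg B h.skew, map_sub, ih,
      h.lieDeriv_chevalleyEilenberg, sub_zero, sub_self, map_zero]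

end IsLieRep

end LieRep

section Nijenhuis

variable {R V W : Type*} [CommRing R] [AddCommGroup V] [Module R V] [AddCommGroup W] [Module R W]
variable {n : ℕ}

/-- The pair `(N, NM)` satisfies the Nijenhuis condition for the bilinear map `B`. It covers both
Nijenhuis operators on a Lie algebra (`B` the bracket and `NM = N`) and Nijenhuis
representations. -/
def IsNijenhuisPair (B : V →ₗ[R] W →ₗ[R] W) (N : V →ₗ[R] V) (NM : W →ₗ[R] W) : Prop :=
  ∀ x w, B (N x) (NM w) = NM (B (N x) w + B x (NM w) - NM (B x w))

/-- The bracket `b` deformed by `N`. -/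
def deformed (b : V →ₗ[R] V →ₗ[R] V) (N : V →ₗ[R] V) : V →ₗ[R] V →ₗ[R] V :=
  b ∘ₗ N + b.compl₂ N - b.compr₂ N

variable {b : V →ₗ[R] V →ₗ[R] V} {B : V →ₗ[R] W →ₗ[R] W} {N : V →ₗ[R] V} {NM : W →ₗ[R] W}

@[simp] theorem deformed_apply (x y : V) :
    deformed b N x y = b (N x) y + b x (N y) - N (b x y) :=
  rfl

theorem deformed_skew (hb : ∀ x y, b x y = -b y x) (x y : V) :
    deformed b N x y = -deformed b N y x := by
  rw [deformed_apply, deformed_apply, hb (N x), hb x, hb x, map_neg]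
  abel

namespace IsLieRep

theorem deformed_jacobi (h : IsLieRep b B) (hN : IsNijenhuisPair b N N) (x y z : V) :
    deformed b N (deformed b N x y) z =
      deformed b N x (deformed b N y z) - deformed b N y (deformed b N x z) := by
  have hbxy_z := hN (b x y) z
  have hx_byz := hN x (b y z)
  have hy_bxz := hN y (b x z)
  have jacobi_xy := h.jacobi (N x) (N y) z
  have jacobi_xz := h.jacobi (N x) y (N z)
  have jacobi_yz := h.jacobi x (N y) (N z)
  have N_jacobi_x := congrArg N (h.jacobi (N x) y z)
  have N_jacobi_y := congrArg N (h.jacobi x (N y) z)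
  have N_jacobi_z := congrArg N (h.jacobi x y (N z))
  have NN_jacobi := congrArg N (congrArg N (h.jacobi x y z))
  have hxy := hN x y
  have hyz := hN y z
  have hxz := hN x z
  simp only [deformed_apply, ← hxy, ← hyz, ← hxz]
  simp only [map_add, map_sub, LinearMap.add_apply, LinearMap.sub_apply] at *
  rw [hbxy_z, hx_byz, hy_bxz, jacobi_xy, jacobi_xz, jacobi_yz]
  linear_combination (norm := module) -N_jacobi_x - N_jacobi_y - N_jacobi_z + NN_jacobi

theorem deformed (h : IsLieRep b B) (hN : IsNijenhuisPair b N N) :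
    IsLieRep (deformed b N) (B ∘ₗ N) where
  skew := deformed_skew h.skew
  jacobi := h.deformed_jacobi hN
  rep x y w := by rw [LinearMap.comp_apply, deformed_apply, ← hN, h.rep]; rfl

/-- The two brackets are compatible because `id + N` is again a Nijenhuis operator, and the
bracket deformed by it is the sum of the two. -/
theorem add_deformed (h : IsLieRep b B) (hN : IsNijenhuisPair b N N) :
    IsLieRep (b + NijLCA.deformed b N) (B + B ∘ₗ N) := by
  have id_add_N : IsNijenhuisPair b (LinearMap.id + N) (LinearMap.id + N) := fun x y => by
    have := hN x y
    simp only [LinearMap.add_apply, LinearMap.id_apply, map_add, map_sub] at this ⊢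
    rw [this]
    abel
  convert h.deformed id_add_N using 1
  · ext x y
    simp only [deformed_apply, LinearMap.add_apply, LinearMap.id_apply, map_add]
    abel
  · rw [LinearMap.comp_add, LinearMap.comp_id]

end IsLieRep

/-- The Lie derivative `L_x` that belongs to `nijenhuisDifferential`. -/
def nijenhuisLieDeriv (b : V →ₗ[R] V →ₗ[R] V) (B : V →ₗ[R] W →ₗ[R] W) (N : V →ₗ[R] V)
    (NM : W →ₗ[R] W) (x : V) : (V [⋀^Fin n]→ₗ[R] W) →ₗ[R] V [⋀^Fin n]→ₗ[R] W :=
  lieDeriv (deformed b N) (B ∘ₗ N) x - postcomp NM ∘ₗ lieDeriv b B x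

theorem nijenhuisLieDeriv_apply (x : V) (F : V [⋀^Fin n]→ₗ[R] W) :
    nijenhuisLieDeriv b B N NM x F =
      lieDeriv (deformed b N) (B ∘ₗ N) x F - postcomp NM (lieDeriv b B x F) :=
  rfl

theorem interior_nijenhuisLieDeriv (x y : V) (F : V [⋀^Fin (n + 1)]→ₗ[R] W) :
    interior y (nijenhuisLieDeriv b B N NM x F) = nijenhuisLieDeriv b B N NM x (interior y F) -
      interior (deformed b N x y) F + postcomp NM (interior (b x y) F) := by
  rw [nijenhuisLieDeriv_apply, map_sub, interior_postcomp, interior_lieDeriv, interior_lieDeriv,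
    nijenhuisLieDeriv_apply, map_sub]
  abel

theorem IsNijenhuisPair.nijenhuisLieDeriv_postcomp (h : IsNijenhuisPair B N NM) (x : V)
    (F : V [⋀^Fin n]→ₗ[R] W) :
    nijenhuisLieDeriv b B N NM x (postcomp NM F) =
      postcomp NM (nijenhuisLieDeriv b B N NM x F) := by
  have postcomp_nijenhuis : postcomp (B (N x)) (postcomp NM F) =
      postcomp NM (postcomp (B (N x)) F + postcomp (B x) (postcomp NM F) -
        postcomp NM (postcomp (B x) F)) := by
    ext v
    exact h x (F v)
  simp only [nijenhuisLieDeriv_apply, lieDeriv_apply, der_postcomp, map_sub, map_add,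
    LinearMap.comp_apply] at postcomp_nijenhuis ⊢
  rw [postcomp_nijenhuis]
  abel

variable [Invertible (2 : R)]

/-- The differential `d_N` of a Nijenhuis operator `N` with coefficients in a Nijenhuis
representation. -/
def nijenhuisDifferential (b : V →ₗ[R] V →ₗ[R] V) (B : V →ₗ[R] W →ₗ[R] W) (N : V →ₗ[R] V)
    (NM : W →ₗ[R] W) : (V [⋀^Fin n]→ₗ[R] W) →ₗ[R] V [⋀^Fin (n + 1)]→ₗ[R] W :=
  chevalleyEilenberg (deformed b N) (B ∘ₗ N) - postcomp NM ∘ₗ chevalleyEilenberg b B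

theorem nijenhuisDifferential_apply (F : V [⋀^Fin n]→ₗ[R] W) :
    nijenhuisDifferential b B N NM F = chevalleyEilenberg (deformed b N) (B ∘ₗ N) F -
      postcomp NM (chevalleyEilenberg b B F) :=
  rfl

theorem interior_nijenhuisDifferential_zero (x : V) (F : V [⋀^Fin 0]→ₗ[R] W) :
    interior x (nijenhuisDifferential b B N NM F) = nijenhuisLieDeriv b B N NM x F := by
  rw [nijenhuisDifferential_apply, map_sub, interior_postcomp, interior_chevalleyEilenberg_zero,
    interior_chevalleyEilenberg_zero, nijenhuisLieDeriv_apply]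

theorem interior_nijenhuisDifferential (hb : ∀ x y, b x y = -b y x) (x : V)
    (F : V [⋀^Fin (n + 1)]→ₗ[R] W) :
    interior x (nijenhuisDifferential b B N NM F) =
      nijenhuisLieDeriv b B N NM x F - nijenhuisDifferential b B N NM (interior x F) := by
  rw [nijenhuisDifferential_apply, map_sub, interior_postcomp,
    interior_chevalleyEilenberg _ (deformed_skew hb), interior_chevalleyEilenberg _ hb,
    nijenhuisLieDeriv_apply, nijenhuisDifferential_apply, map_sub]
  abel

theorem IsNijenhuisPair.nijenhuisDifferential_postcomp (h : IsNijenhuisPair B N NM)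
    (hb : ∀ x y, b x y = -b y x) (F : V [⋀^Fin n]→ₗ[R] W) :
    nijenhuisDifferential b B N NM (postcomp NM F) =
      postcomp NM (nijenhuisDifferential b B N NM F) := by
  induction n with
  | zero =>
    refine ext_interior fun x => ?_
    rw [interior_postcomp, interior_nijenhuisDifferential_zero,
      interior_nijenhuisDifferential_zero, h.nijenhuisLieDeriv_postcomp]
  | succ n ih =>
    refine ext_interior fun x => ?_
    rw [interior_postcomp, interior_nijenhuisDifferential hb, interior_nijenhuisDifferential hb,
      h.nijenhuisLieDeriv_postcomp, interior_postcomp, ih, map_sub]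

theorem nijenhuisDifferential_nijenhuisDifferential (h : IsLieRep b B)
    (hN : IsNijenhuisPair b N N) (hNM : IsNijenhuisPair B N NM) (F : V [⋀^Fin n]→ₗ[R] W) :
    nijenhuisDifferential b B N NM (nijenhuisDifferential b B N NM F) = 0 := by
  have sq := h.chevalleyEilenberg_chevalleyEilenberg F
  have sq_deformed := (h.deformed hN).chevalleyEilenberg_chevalleyEilenberg F
  have mixed := (h.add_deformed hN).chevalleyEilenberg_chevalleyEilenberg F
  simp only [chevalleyEilenberg_add_left, LinearMap.add_apply, map_add, sq, sq_deformed, zero_add,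
    add_zero] at mixed
  have comm := hNM.nijenhuisDifferential_postcomp h.skew (chevalleyEilenberg b B F)
  rw [nijenhuisDifferential_apply F, map_sub, comm, nijenhuisDifferential_apply,
    nijenhuisDifferential_apply, sq, sq_deformed, zero_sub, map_zero, sub_zero, ← neg_add',
    ← map_add, (add_comm _ _).trans mixed, map_zero, neg_zero]

end Nijenhuis

section ExplicitFormula

open AlternatingMap (alternatizeUncurryFin alternatizeUncurryFinLM)

variable {R V W : Type*} [CommRing R] [AddCommGroup V] [Module R V] [AddCommGroup W] [Module R W]
variable {n : ℕ} {b : V →ₗ[R] V →ₗ[R] V}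

theorem alternatizeUncurryFin_der (hb : ∀ x y, b x y = -b y x)
    (F : V [⋀^Fin (n + 1)]→ₗ[R] W) (v : Fin (n + 2) → V) :
    alternatizeUncurryFin ((der ∘ₗ b).flip F) v =
      -((2 : R) • ∑ j : Fin (n + 2), ∑ i : Fin (n + 1), if i.castSucc < j then
        (-1 : ℤ) ^ (i + j : ℕ) •
          F (Fin.cons (b (v i.castSucc) (v j)) (i.removeNth (j.removeNth v))) else 0) := by
  have removeNth_swap (i j : Fin (n + 1)) (hij : i ≤ j) :
      i.removeNth (j.succ.removeNth v) = j.removeNth (i.castSucc.removeNth v) := by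
    rw [Fin.removeNth_removeNth_eq_swap]
    simp [Fin.predAbove, hij, Fin.succAbove]
  have h : (der ∘ₗ b).flip F = alternatizeUncurryFinLM ∘ₗ (b.compr₂ F.curryLeft) := rfl
  rw [h, AlternatingMap.alternatizeUncurryFin_alternatizeUncurryFinLM_comp_apply]
  conv_rhs => rw [Fin.sum_univ_succ]
  simp only [Fin.not_lt_zero, if_false, Finset.sum_const_zero, zero_add, Fin.castSucc_lt_succ_iff]
  rw [Finset.sum_comm (s := Finset.univ (α := Fin (n + 1))), Finset.smul_sum,
    ← Finset.sum_neg_distrib]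
  refine Finset.sum_congr rfl fun i _ => ?_
  rw [← Finset.sum_filter, Finset.smul_sum, ← Finset.sum_neg_distrib,
    Finset.filter_le_eq_Ici]
  refine Finset.sum_congr rfl fun j hj => ?_
  rw [removeNth_swap i j (Finset.mem_Ici.1 hj), LinearMap.compr₂_apply, LinearMap.compr₂_apply,
    hb (v j.succ), map_neg, AlternatingMap.neg_apply, sub_neg_eq_add, ← two_smul R, smul_comm,
    Fin.val_succ, ← add_assoc, pow_succ, mul_neg_one, neg_smul, smul_neg, neg_neg]
  rfl

theorem chevalleyEilenberg_apply_succ [Invertible (2 : R)] (hb : ∀ x y, b x y = -b y x)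
    (B : V →ₗ[R] W →ₗ[R] W) (F : V [⋀^Fin (n + 1)]→ₗ[R] W) (v : Fin (n + 2) → V) :
    chevalleyEilenberg b B F v =
      (∑ j : Fin (n + 2), (-1 : ℤ) ^ (j : ℕ) • B (v j) (F (j.removeNth v))) +
        ∑ j : Fin (n + 2), ∑ i : Fin (n + 1), if i.castSucc < j then (-1 : ℤ) ^ (i + j : ℕ) •
          F (Fin.cons (b (v i.castSucc) (v j)) (i.removeNth (j.removeNth v))) else 0 := by
  have h : (lieDeriv ((⅟2 : R) • b) B).flip F =
      (postcomp ∘ₗ B).flip F + (-⅟2 : R) • (der ∘ₗ b).flip F := by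
    ext1 x
    simp only [LinearMap.flip_apply, lieDeriv_apply, LinearMap.add_apply, LinearMap.smul_apply,
      LinearMap.comp_apply, map_smul, neg_smul, sub_eq_add_neg]
  rw [chevalleyEilenberg_apply, h, AlternatingMap.alternatizeUncurryFin_add,
    AlternatingMap.alternatizeUncurryFin_smul, AlternatingMap.add_apply,
    AlternatingMap.smul_apply, alternatizeUncurryFin_der hb, neg_smul, smul_neg, neg_neg,
    invOf_smul_smul, AlternatingMap.alternatizeUncurryFin_apply]
  rfl

end ExplicitFormula

section Xi

variable {R V W : Type*} [CommRing R] [AddCommGroup V] [Module R V] [AddCommGroup W] [Module R W]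
variable {n : ℕ}

/-- The term of `ξF` that belongs to a set `S` of arguments, up to sign: `NM^|S|` is applied to
the value of `F`, and `N` to the arguments outside `S`. -/
def xiTerm (N : V →ₗ[R] V) (NM : W →ₗ[R] W) (F : V [⋀^Fin n]→ₗ[R] W) (S : Finset (Fin n)) :
    MultilinearMap R (fun _ : Fin n => V) W :=
  (NM ^ S.card).compMultilinearMap
    (F.toMultilinearMap.compLinearMap fun i => if i ∈ S then LinearMap.id else N)

theorem xiTerm_apply (N : V →ₗ[R] V) (NM : W →ₗ[R] W) (F : V [⋀^Fin n]→ₗ[R] W)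
    (S : Finset (Fin n)) (v : Fin n → V) :
    xiTerm N NM F S v = (NM ^ S.card) (F fun i => if i ∈ S then v i else N (v i)) := by
  refine congrArg (NM ^ S.card) (congrArg F (funext fun i => ?_))
  by_cases hi : i ∈ S <;> simp [hi]

theorem xiTerm_map_swap (N : V →ₗ[R] V) (NM : W →ₗ[R] W) (F : V [⋀^Fin n]→ₗ[R] W)
    {i j : Fin n} (hij : i ≠ j) {v : Fin n → V} (hv : v i = v j) (S : Finset (Fin n)) :
    xiTerm N NM F (S.map (Equiv.swap i j).toEmbedding) v = -xiTerm N NM F S v := by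
  have swap_args (a : Fin n) : v (Equiv.swap i j a) = v a := by
    rw [Equiv.swap_apply_def]
    split_ifs with hi hj
    · rw [hi, hv]
    · rw [hj, hv]
    · rfl
  rw [xiTerm_apply, xiTerm_apply, Finset.card_map, ← map_neg, ← F.map_swap _ hij]
  refine congrArg (NM ^ S.card) (congrArg F (funext fun a => ?_))
  simp only [Finset.mem_map_equiv, Equiv.symm_swap, Function.comp_apply, swap_args]

theorem xiTerm_eq_zero (N : V →ₗ[R] V) (NM : W →ₗ[R] W) (F : V [⋀^Fin n]→ₗ[R] W)
    {i j : Fin n} (hij : i ≠ j) {v : Fin n → V} (hv : v i = v j) {S : Finset (Fin n)}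
    (hS : S.map (Equiv.swap i j).toEmbedding = S) : xiTerm N NM F S v = 0 := by
  have mem_iff : i ∈ S ↔ j ∈ S := by
    conv_lhs => rw [← hS]
    rw [Finset.mem_map_equiv, Equiv.symm_swap, Equiv.swap_apply_left]
  rw [xiTerm_apply, F.map_eq_zero_of_eq _ (by simp only [hv, mem_iff]) hij, map_zero]

theorem sum_xiTerm_eq_zero (N : V →ₗ[R] V) (NM : W →ₗ[R] W) (F : V [⋀^Fin n]→ₗ[R] W)
    {i j : Fin n} (hij : i ≠ j) {v : Fin n → V} (hv : v i = v j) :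
    ∑ S : Finset (Fin n), (-1 : ℤ) ^ S.card • xiTerm N NM F S v = 0 := by
  refine Finset.sum_involution (fun S _ => S.map (Equiv.swap i j).toEmbedding)
    (fun S _ => ?_) (fun S _ hS hfix => hS ?_) (fun _ _ => Finset.mem_univ _) fun S _ => ?_
  · rw [xiTerm_map_swap N NM F hij hv, Finset.card_map, smul_neg, add_neg_cancel]
  · rw [xiTerm_eq_zero N NM F hij hv hfix, smul_zero]
  · ext a
    simp only [Finset.mem_map_equiv, Equiv.symm_swap, Equiv.swap_apply_self]

/-- The map `ξ` on alternating maps. -/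
def xi (N : V →ₗ[R] V) (NM : W →ₗ[R] W) :
    (V [⋀^Fin n]→ₗ[R] W) →ₗ[R] V [⋀^Fin n]→ₗ[R] W where
  toFun F :=
    { toMultilinearMap := ∑ S : Finset (Fin n), (-1 : ℤ) ^ S.card • xiTerm N NM F S
      map_eq_zero_of_eq' v i j hv hij := by
        simpa using sum_xiTerm_eq_zero N NM F hij hv }
  map_add' F G := by
    ext v
    simp [xiTerm_apply, Finset.sum_add_distrib]
  map_smul' c F := by
    ext v
    simp [xiTerm_apply, Finset.smul_sum, smul_comm c]

variable {N : V →ₗ[R] V} {NM : W →ₗ[R] W}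

theorem xi_apply (F : V [⋀^Fin n]→ₗ[R] W) (v : Fin n → V) :
    xi N NM F v = ∑ S : Finset (Fin n), (-1 : ℤ) ^ S.card •
      (NM ^ S.card) (F fun i => if i ∈ S then v i else N (v i)) := by
  simp [xi, xiTerm_apply]

theorem xi_zero_degree (F : V [⋀^Fin 0]→ₗ[R] W) : xi N NM F = F := by
  ext v
  rw [xi_apply, Fintype.sum_subsingleton _ (∅ : Finset (Fin 0)), Finset.card_empty, pow_zero,
    pow_zero, one_smul, Module.End.one_apply]
  exact congrArg F (Subsingleton.elim _ _)

theorem sum_finset_fin_succ {A : Type*} [AddCommMonoid A] (f : Finset (Fin (n + 1)) → A) :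
    ∑ S, f S = ∑ S : Finset (Fin n), f (S.map (Fin.succEmb n)) +
      ∑ S : Finset (Fin n), f (insert 0 (S.map (Fin.succEmb n))) := by
  have powerset_map : ((Finset.univ : Finset (Fin n)).map (Fin.succEmb n)).powerset =
      Finset.univ.map (Finset.mapEmbedding (Fin.succEmb n)).toEmbedding := by
    ext S
    simp only [Finset.mem_powerset, Finset.subset_map_iff, Finset.mem_map, Finset.mem_univ,
      true_and, Finset.subset_univ]
    exact exists_congr fun T => eq_comm
  have univ_succ : (Finset.univ : Finset (Fin (n + 1))) =
      insert 0 (Finset.univ.map (Fin.succEmb n)) := by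
    rw [Fin.univ_succ, Finset.cons_eq_insert]
    rfl
  rw [← Finset.powerset_univ, univ_succ, Finset.sum_powerset_insert (by simp), powerset_map,
    Finset.sum_map, Finset.sum_map]
  rfl

theorem interior_xi (x : V) (F : V [⋀^Fin (n + 1)]→ₗ[R] W) :
    interior x (xi N NM F) =
      xi N NM (interior (N x) F) - postcomp NM (xi N NM (interior x F)) := by
  ext v
  have args_of_notMem (S : Finset (Fin n)) :
      (fun i => if i ∈ S.map (Fin.succEmb n) then (Fin.cons x v : Fin (n + 1) → V) i
        else N ((Fin.cons x v : Fin (n + 1) → V) i)) =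
      (Fin.cons (N x) fun i => if i ∈ S then v i else N (v i) : Fin (n + 1) → V) :=
    funext (Fin.cases (by simp) fun i => by simp)
  have args_of_mem (S : Finset (Fin n)) :
      (fun i => if i ∈ insert 0 (S.map (Fin.succEmb n)) then (Fin.cons x v : Fin (n + 1) → V) i
        else N ((Fin.cons x v : Fin (n + 1) → V) i)) =
      (Fin.cons x fun i => if i ∈ S then v i else N (v i) : Fin (n + 1) → V) :=
    funext (Fin.cases (by simp) fun i => by simp)
  have card_insert (S : Finset (Fin n)) : (insert 0 (S.map (Fin.succEmb n))).card = S.card + 1 := by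
    rw [Finset.card_insert_of_notMem (by simp), Finset.card_map]
  rw [interior_apply, xi_apply, sum_finset_fin_succ, AlternatingMap.sub_apply, sub_eq_add_neg]
  simp only [args_of_notMem, args_of_mem, card_insert, Finset.card_map, xi_apply, postcomp_apply,
    map_sum, map_zsmul, interior_apply, pow_succ', neg_mul, one_mul, neg_smul,
    Finset.sum_neg_distrib, Module.End.mul_apply]

variable {b : V →ₗ[R] V →ₗ[R] V} {B : V →ₗ[R] W →ₗ[R] W}

theorem xi_lieDeriv (hN : IsNijenhuisPair b N N) (hNM : IsNijenhuisPair B N NM) (x : V)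
    (F : V [⋀^Fin n]→ₗ[R] W) :
    xi N NM (lieDeriv b B (N x) F) - postcomp NM (xi N NM (lieDeriv b B x F)) =
      nijenhuisLieDeriv b B N NM x (xi N NM F) := by
  induction n with
  | zero =>
    simp only [xi_zero_degree, nijenhuisLieDeriv_apply, lieDeriv_zero_degree]
    rfl
  | succ n ih =>
    refine ext_interior fun y => ?_
    simp only [interior_xi, interior_lieDeriv, interior_postcomp, interior_nijenhuisLieDeriv,
      map_sub, hNM.nijenhuisLieDeriv_postcomp, ← ih, hN x y, deformed_apply, map_add,
      LinearMap.sub_apply, LinearMap.add_apply]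
    abel

theorem xi_chevalleyEilenberg [Invertible (2 : R)] (hb : ∀ x y, b x y = -b y x)
    (hN : IsNijenhuisPair b N N) (hNM : IsNijenhuisPair B N NM) (F : V [⋀^Fin n]→ₗ[R] W) :
    xi N NM (chevalleyEilenberg b B F) = nijenhuisDifferential b B N NM (xi N NM F) := by
  induction n with
  | zero =>
    refine ext_interior fun x => ?_
    rw [interior_xi, interior_chevalleyEilenberg_zero, interior_chevalleyEilenberg_zero,
      interior_nijenhuisDifferential_zero, xi_lieDeriv hN hNM]
  | succ n ih =>
    refine ext_interior fun x => ?_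
    simp only [interior_xi, interior_chevalleyEilenberg B hb, interior_nijenhuisDifferential hb,
      ← xi_lieDeriv hN hNM x F, map_sub, ih, hNM.nijenhuisDifferential_postcomp hb]
    abel

end Xi

section LamPoly

variable {M : Type v} [AddCommGroup M] [Module DRing M] {k l : ℕ}

namespace LamPoly

/-- The element `Q m` of `M[λ₁, …, λₖ]`. -/
noncomputable def mk (Q : LamRing k) (m : M) : LamPoly k M :=
  Q ⊗ₜ[DRing] m

theorem smul_mk (P Q : LamRing k) (m : M) : P • mk Q m = mk (P * Q) m :=
  rfl

theorem mk_add_left (P Q : LamRing k) (m : M) : mk (P + Q) m = mk P m + mk Q m :=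
  TensorProduct.add_tmul P Q m

theorem mk_add_right (Q : LamRing k) (m m' : M) : mk Q (m + m') = mk Q m + mk Q m' :=
  TensorProduct.tmul_add Q m m'

theorem mk_smul_right (Q : LamRing k) (P : DRing) (m : M) :
    mk Q (P • m) = mk (MvPolynomial.C P * Q) m := by
  rw [← MvPolynomial.smul_eq_C_mul]
  exact (TensorProduct.smul_tmul P Q m).symm

theorem subst_mk (μ : Fin k → LamRing l) (Q : LamRing k) (m : M) :
    subst μ (mk Q m) = mk (MvPolynomial.aeval μ Q) m :=
  rfl

theorem ext_mk (T : M →ₗ[DRing] M) (Q : LamRing k) (m : M) : ext k T (mk Q m) = mk Q (T m) :=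
  rfl

@[elab_as_elim]
theorem induction_on {p : LamPoly k M → Prop} (v : LamPoly k M) (mk : ∀ Q m, p (mk Q m))
    (add : ∀ v w, p v → p w → p (v + w)) : p v := by
  have mk_zero : LamPoly.mk (0 : LamRing k) (0 : M) = 0 := TensorProduct.zero_tmul _ _
  exact TensorProduct.induction_on v (mk_zero ▸ mk 0 0) mk add

theorem coeffs_add (v w : LamPoly k M) : coeffs (v + w) = coeffs v + coeffs w :=
  map_add (TensorProduct.equivFinsuppOfBasisLeft (MvPolynomial.basisMonomials (Fin k) DRing)) v w

theorem coeffs_mk_monomial (a : Fin k →₀ ℕ) (P : DRing) (m : M) :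
    coeffs (mk (MvPolynomial.monomial a P) m) = Finsupp.single a (P • m) := by
  refine (TensorProduct.equivFinsuppOfBasisLeft_apply_tmul _ _ _).trans ?_
  change Finsupp.mapRange _ _ (Finsupp.single a P) = _
  rw [Finsupp.mapRange_single]

end LamPoly

variable {R : Type*} [CommRing R] [Algebra ℂ R]

/-- The homomorphism with `λᵢ ↦ sᵢ` and `∂ ↦ -z`. -/
noncomputable def lamHom (s : Fin k → R) (z : R) : LamRing k →ₐ[ℂ] R where
  toRingHom := MvPolynomial.eval₂Hom (Polynomial.aeval (-z) : DRing →ₐ[ℂ] R).toRingHom s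
  commutes' c := by
    rw [IsScalarTower.algebraMap_apply ℂ DRing (LamRing k)]
    simp [MvPolynomial.algebraMap_eq]

@[simp] theorem lamHom_lv (s : Fin k → R) (z : R) (i : Fin k) : lamHom s z (lv i) = s i :=
  MvPolynomial.eval₂Hom_X' _ _ _

@[simp] theorem lamHom_del (s : Fin k → R) (z : R) : lamHom s z (del k) = -z :=
  (MvPolynomial.eval₂Hom_C _ _ _).trans (Polynomial.aeval_X (-z))

theorem lamRing_hom_ext {φ ψ : LamRing k →ₐ[ℂ] R} (lv : ∀ i, φ (lv i) = ψ (lv i))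
    (del : φ (del k) = ψ (del k)) : φ = ψ := by
  have hC : (φ : LamRing k →+* R).comp MvPolynomial.C =
      (ψ : LamRing k →+* R).comp MvPolynomial.C :=
    Polynomial.ringHom_ext (fun c => (φ.commutes c).trans (ψ.commutes c).symm) del
  exact AlgHom.coe_ringHom_injective (MvPolynomial.ringHom_ext (RingHom.congr_fun hC) lv)

theorem lamRing_hom_C (φ : LamRing k →ₐ[ℂ] R) (P : DRing) :
    φ (MvPolynomial.C P) = Polynomial.aeval (φ (del k)) P := by
  have h : φ.comp (IsScalarTower.toAlgHom ℂ DRing (LamRing k)) = Polynomial.aeval (φ (del k)) := by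
    ext
    simp [MvPolynomial.algebraMap_eq, del]
  exact DFunLike.congr_fun h P

end LamPoly

section CurrentModule

variable (R : Type*) [CommRing R] [Algebra ℂ R]
variable (M : Type v) [AddCommGroup M] [Module DRing M]

/-- The relations that define `CurrentModule R M`. -/
noncomputable def currentRelations : Submodule R ((R × M) →₀ R) :=
  Submodule.span R
    ({x | ∃ (z : R) (m m' : M), x = Finsupp.single (z, m + m') 1 - Finsupp.single (z, m) 1 -
        Finsupp.single (z, m') 1} ∪
      {x | ∃ (z : R) (P : DRing) (m : M), x = Finsupp.single (z, P • m) 1 -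
        Polynomial.aeval (-z) P • Finsupp.single (z, m) 1})

/-- The direct sum over all `z : R` of the base changes of `M` along `ℂ[∂] → R`, `∂ ↦ -z`, given by
generators and relations. If the elements of `M` are thought of as fields `m(x)`, then the
generator `m` in the summand of index `z` stands for `∫ exp(zx) m(x) dx`, and `∂ ↦ -z` is
integration by parts. -/
abbrev CurrentModule : Type _ :=
  ((R × M) →₀ R) ⧸ currentRelations R M

variable {R M}

namespace CurrentModule

/-- The element `m` of the summand of `CurrentModule R M` with index `z`. -/
noncomputable def of (z : R) : M →+ CurrentModule R M :=
  AddMonoidHom.mk' (fun m => (currentRelations R M).mkQ (Finsupp.single (z, m) 1)) fun m m' => by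
    rw [← map_add, ← sub_eq_zero, ← map_sub, Submodule.mkQ_apply, Submodule.Quotient.mk_eq_zero,
      ← sub_sub]
    exact Submodule.subset_span (Or.inl ⟨z, m, m', rfl⟩)

theorem of_smul (z : R) (P : DRing) (m : M) :
    of z (P • m) = Polynomial.aeval (-z) P • of z m := by
  change (currentRelations R M).mkQ _ = _ • (currentRelations R M).mkQ _
  rw [← map_smul, ← sub_eq_zero, ← map_sub, Submodule.mkQ_apply, Submodule.Quotient.mk_eq_zero]
  exact Submodule.subset_span (Or.inr ⟨z, P, m, rfl⟩)

variable {W : Type*} [AddCommGroup W] [Module R W]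

theorem hom_ext {f g : CurrentModule R M →ₗ[R] W} (h : ∀ z m, f (of z m) = g (of z m)) :
    f = g :=
  Submodule.linearMap_qext _ (Finsupp.lhom_ext' fun x => LinearMap.ext_ring (h x.1 x.2))

/-- The condition for `φ : R × M → W` to extend to a linear map on `CurrentModule R M`. -/
structure IsCompatible (φ : R → M → W) : Prop where
  map_add : ∀ z m m', φ z (m + m') = φ z m + φ z m'
  map_smul : ∀ z (P : DRing) m, φ z (P • m) = Polynomial.aeval (-z) P • φ z m

namespace IsCompatible

theorem of_map_X_smul [Module ℂ M] [IsScalarTower ℂ DRing M] {φ : R → M → W}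
    (map_add : ∀ z m m', φ z (m + m') = φ z m + φ z m')
    (map_smul : ∀ z (c : ℂ) m, φ z (c • m) = algebraMap ℂ R c • φ z m)
    (map_X_smul : ∀ z m, φ z ((Polynomial.X : DRing) • m) = -(z • φ z m)) : IsCompatible φ := by
  refine ⟨map_add, fun z P m => ?_⟩
  induction P using Polynomial.induction_on generalizing m with
  | C c =>
    have h : (Polynomial.C c : DRing) • m = c • m := algebraMap_smul DRing c m
    rw [h, map_smul, Polynomial.aeval_C]
  | add p q hp hq => rw [add_smul, map_add, hp, hq, _root_.map_add, add_smul]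
  | monomial n c h =>
    rw [pow_succ, ← mul_assoc, mul_smul, h, map_X_smul, map_mul _ _ Polynomial.X,
      Polynomial.aeval_X, mul_smul, neg_smul]

/-- The linear map on `CurrentModule R M` that extends `φ`. -/
noncomputable def lift {φ : R → M → W} (h : IsCompatible φ) : CurrentModule R M →ₗ[R] W :=
  (currentRelations R M).liftQ (Finsupp.linearCombination R fun x : R × M => φ x.1 x.2) <| by
    refine Submodule.span_le.2 ?_
    rintro _ (⟨z, m, m', rfl⟩ | ⟨z, P, m, rfl⟩)
    · simp [h.map_add]
    · simp [h.map_smul]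

@[simp] theorem lift_of {φ : R → M → W} (h : IsCompatible φ) (z : R) (m : M) :
    h.lift (of z m) = φ z m :=
  ((currentRelations R M).liftQ_apply _ _).trans (by simp)

end IsCompatible

/-- The map of `CurrentModule R M` induced by a `ℂ[∂]`-linear map. -/
noncomputable def map (R : Type*) [CommRing R] [Algebra ℂ R] (T : M →ₗ[DRing] M) :
    CurrentModule R M →ₗ[R] CurrentModule R M :=
  IsCompatible.lift (φ := fun z m => of z (T m))
    ⟨fun z m m' => by rw [map_add, map_add], fun z P m => by rw [map_smul, of_smul]⟩

@[simp] theorem map_of (T : M →ₗ[DRing] M) (z : R) (m : M) : map R T (of z m) = of z (T m) :=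
  IsCompatible.lift_of _ z m

protected theorem map_pow (T : M →ₗ[DRing] M) (n : ℕ) : map R (T ^ n) = map R T ^ n := by
  refine hom_ext fun z m => ?_
  rw [map_of]
  induction n generalizing m with
  | zero => rfl
  | succ n ih =>
    rw [pow_succ, pow_succ, Module.End.mul_apply, Module.End.mul_apply, map_of, ih]

end CurrentModule

end CurrentModule

section Evaluation

variable {R : Type*} [CommRing R] [Algebra ℂ R]
variable {M : Type v} [AddCommGroup M] [Module DRing M] {k l : ℕ}

namespace CurrentModule

/-- Evaluation of `M[λ₁, …, λₖ]` in `CurrentModule R M` along `φ : ℂ[∂][λ₁, …, λₖ] → R`. The values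
lie in the summand of index `-φ(∂)`. -/
noncomputable def eval (φ : LamRing k →ₐ[ℂ] R) : LamPoly k M →+ CurrentModule R M :=
  TensorProduct.liftAddHom
    (AddMonoidHom.mk' (fun Q => AddMonoidHom.mk' (fun m => φ Q • of (-φ (del k)) m)
      fun m m' => by rw [map_add, smul_add])
      fun Q Q' => by ext m; simp [add_smul])
    fun P Q m => by
      change φ (P • Q) • of (-φ (del k)) m = φ Q • of (-φ (del k)) (P • m)
      rw [of_smul, neg_neg, ← lamRing_hom_C, smul_smul, ← map_mul, MvPolynomial.smul_eq_C_mul,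
        mul_comm]

theorem eval_mk (φ : LamRing k →ₐ[ℂ] R) (Q : LamRing k) (m : M) :
    eval φ (LamPoly.mk Q m) = φ Q • of (-φ (del k)) m :=
  rfl

theorem eval_smul (φ : LamRing k →ₐ[ℂ] R) (P : LamRing k) (v : LamPoly k M) :
    eval φ (P • v) = φ P • eval φ v := by
  induction v using LamPoly.induction_on with
  | mk Q m => rw [LamPoly.smul_mk, eval_mk, eval_mk, map_mul, mul_smul]
  | add v w hv hw => rw [smul_add, map_add, map_add, hv, hw, smul_add]

theorem eval_complex_smul (φ : LamRing k →ₐ[ℂ] R) (c : ℂ) (v : LamPoly k M) :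
    eval φ (c • v) = algebraMap ℂ R c • eval φ v := by
  rw [← algebraMap_smul (LamRing k) c v, eval_smul, AlgHom.commutes]

theorem eval_subst {φ : LamRing l →ₐ[ℂ] R} (ψ : LamRing k →ₐ[ℂ] R) {μ : Fin k → LamRing l}
    (hμ : ∀ i, φ (μ i) = ψ (lv i)) (hdel : φ (del l) = ψ (del k)) (v : LamPoly k M) :
    eval φ (subst μ v) = eval ψ v := by
  have hφ : φ.comp ((MvPolynomial.aeval μ : LamRing k →ₐ[DRing] LamRing l).restrictScalars ℂ) =
      ψ := by
    refine lamRing_hom_ext (fun i => ?_) ?_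
    · exact (congrArg φ (MvPolynomial.aeval_X μ i)).trans (hμ i)
    · exact (congrArg φ (MvPolynomial.aeval_C μ _)).trans hdel
  induction v using LamPoly.induction_on with
  | mk Q m => rw [LamPoly.subst_mk, eval_mk, eval_mk, hdel, ← hφ]; rfl
  | add v w hv hw => rw [map_add, map_add, map_add, hv, hw]

theorem eval_ext (φ : LamRing k →ₐ[ℂ] R) (T : M →ₗ[DRing] M) (v : LamPoly k M) :
    eval φ (ext k T v) = map R T (eval φ v) := by
  induction v using LamPoly.induction_on with
  | mk Q m => rw [LamPoly.ext_mk, eval_mk, eval_mk, map_smul, map_of]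
  | add v w hv hw => rw [map_add, map_add, map_add, map_add, hv, hw]

theorem eval_eq_sum_coeffs (φ : LamRing k →ₐ[ℂ] R) (v : LamPoly k M) :
    eval φ v = (coeffs v).sum fun a m => (∏ i, φ (lv i) ^ a i) • of (-φ (del k)) m := by
  have sum_add (v w : LamPoly k M) :
      ((coeffs (v + w)).sum fun a m => (∏ i, φ (lv i) ^ a i) • of (-φ (del k)) m) =
        ((coeffs v).sum fun a m => (∏ i, φ (lv i) ^ a i) • of (-φ (del k)) m) +
          (coeffs w).sum fun a m => (∏ i, φ (lv i) ^ a i) • of (-φ (del k)) m := by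
    rw [LamPoly.coeffs_add, Finsupp.sum_add_index'] <;> simp
  induction v using LamPoly.induction_on with
  | add v w hv hw => rw [map_add, hv, hw, sum_add]
  | mk Q m =>
    induction Q using MvPolynomial.induction_on' with
    | add P Q hP hQ => rw [LamPoly.mk_add_left, map_add, hP, hQ, sum_add]
    | monomial a P =>
      rw [eval_mk, LamPoly.coeffs_mk_monomial, Finsupp.sum_single_index (by simp), of_smul,
        neg_neg, ← lamRing_hom_C, MvPolynomial.monomial_eq, map_mul, mul_comm, mul_smul,
        Finsupp.prod_fintype _ _ (by simp), map_prod]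
      simp only [map_pow, lv]

theorem eval_evalWith {A : Type u} [AddCommGroup A] [Module DRing A] {φ : LamRing l →ₐ[ℂ] R}
    (ψ : LamRing k →ₐ[ℂ] R) {μ : Fin k → LamRing l} (hμ : ∀ i, φ (μ i) = ψ (lv i))
    {F : A → LamPoly l M} (Φ : CurrentModule R A →ₗ[R] CurrentModule R M)
    (hF : ∀ c, eval φ (F c) = Φ (of (-ψ (del k)) c)) (v : LamPoly k A) :
    eval φ (evalWith μ F v) = Φ (eval ψ v) := by
  rw [evalWith, map_finsuppSum, eval_eq_sum_coeffs ψ, map_finsuppSum]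
  refine Finsupp.sum_congr fun a _ => ?_
  simp only [eval_smul, hF, map_smul, map_prod, map_pow, hμ]

theorem eval_id_injective :
    Function.Injective
      (eval (AlgHom.id ℂ (LamRing k)) : LamPoly k M →+ CurrentModule (LamRing k) M) := by
  classical
  have compatible : IsCompatible (R := LamRing k) (M := M) fun z m =>
      if z = -del k then LamPoly.mk (1 : LamRing k) m else 0 := by
    refine ⟨fun z m m' => ?_, fun z P m => ?_⟩
    · split_ifs
      · exact LamPoly.mk_add_right _ _ _
      · rw [add_zero]
    · split_ifs with h
      · rw [h, neg_neg, LamPoly.mk_smul_right, LamPoly.smul_mk]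
        exact congrArg (fun Q => LamPoly.mk (Q * 1) m)
          (lamRing_hom_C (AlgHom.id ℂ (LamRing k)) P)
      · rw [smul_zero]
  refine Function.LeftInverse.injective (g := compatible.lift) fun v => ?_
  induction v using LamPoly.induction_on with
  | mk Q m =>
    rw [eval_mk, map_smul, IsCompatible.lift_of, AlgHom.id_apply, AlgHom.id_apply, if_pos rfl,
      LamPoly.smul_mk, mul_one]
  | add v w hv hw => rw [map_add, map_add, hv, hw]

end CurrentModule

end Evaluation

section Brackets

open CurrentModule

variable {R : Type*} [CommRing R] [Algebra ℂ R]
variable {A : Type u} [AddCommGroup A] [Module DRing A]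
variable {M : Type v} [AddCommGroup M] [Module DRing M]

/-- The bilinear map `Bh` on the current modules is induced by the `λ`-action `B`. -/
def Induces (B : A → M → LamPoly 1 M)
    (Bh : CurrentModule R A →ₗ[R] CurrentModule R M →ₗ[R] CurrentModule R M) : Prop :=
  ∀ s t p m, Bh (of s p) (of t m) = eval (lamHom ![s] (s + t)) (B p m)

theorem exists_induces [Module ℂ A] [IsScalarTower ℂ DRing A] [Module ℂ M] [IsScalarTower ℂ DRing M]
    (B : A →ₗ[ℂ] M →ₗ[ℂ] LamPoly 1 M)
    (del_left : ∀ p m, B ((Polynomial.X : DRing) • p) m = -((lv 0 : LamRing 1) • B p m))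
    (del_right : ∀ p m, B p ((Polynomial.X : DRing) • m) = (del 1 + lv 0) • B p m) :
    ∃ Bh : CurrentModule R A →ₗ[R] CurrentModule R M →ₗ[R] CurrentModule R M,
      Induces (fun p m => B p m) Bh := by
  have compatible_right (s : R) (p : A) :
      IsCompatible fun (t : R) (m : M) => eval (lamHom ![s] (s + t)) (B p m) := by
    refine .of_map_X_smul (fun t m m' => ?_) (fun t c m => ?_) fun t m => ?_
    · rw [map_add, map_add]
    · rw [map_smul, eval_complex_smul]
    · rw [del_right, eval_smul, map_add, lamHom_del, lamHom_lv, Matrix.cons_val_zero,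
        neg_add_rev, neg_add_cancel_right, neg_smul]
  have compatible_left : IsCompatible fun (s : R) (p : A) => (compatible_right s p).lift := by
    refine .of_map_X_smul (fun s p p' => ?_) (fun s c p => ?_) fun s p => ?_ <;>
      refine hom_ext fun t m => ?_
    · simp
    · simp [eval_complex_smul]
    · simp [del_left, eval_smul]
  exact ⟨compatible_left.lift, fun s t p m => by
    rw [IsCompatible.lift_of, IsCompatible.lift_of]⟩

namespace Induces

variable {B : A → M → LamPoly 1 M}
  {Bh : CurrentModule R A →ₗ[R] CurrentModule R M →ₗ[R] CurrentModule R M}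

theorem eval_opAct (hB : Induces B Bh) {k l : ℕ} {φ : LamRing l →ₐ[ℂ] R} (ψ : LamRing k →ₐ[ℂ] R)
    (p : A) (s : LamRing l) {μ : Fin k → LamRing l} (hμ : ∀ i, φ (μ i) = ψ (lv i))
    (hdel : φ (del l) + φ s = ψ (del k)) (v : LamPoly k M) :
    eval φ (opAct B p s μ v) = Bh (of (φ s) p) (eval ψ v) := by
  refine eval_evalWith ψ hμ _ (fun m => ?_) v
  rw [hB]
  refine eval_subst _ (Fin.forall_fin_one.2 ?_) ?_ _
  · simp
  · simp [← hdel]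

theorem eval_opComp (hB : Induces B Bh) {l : ℕ} {φ : LamRing l →ₐ[ℂ] R} (ψ : LamRing 1 →ₐ[ℂ] R)
    (w : LamPoly 1 A) (s t : LamRing l) (hs : φ s = ψ (lv 0)) (ht : φ t = -ψ (del 1)) (m : M) :
    eval φ (opComp B w s t m) = Bh (eval ψ w) (of (-φ (del l) - φ t) m) := by
  refine eval_evalWith ψ (Fin.forall_fin_one.2 hs) (Bh.flip _) (fun c => ?_) w
  rw [LinearMap.flip_apply, hB]
  refine eval_subst _ (Fin.forall_fin_one.2 ?_) ?_ _ <;> simp [ht]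

theorem isNijenhuisPair (hB : Induces B Bh) {N : A →ₗ[DRing] A} {NM : M →ₗ[DRing] M}
    (h : ∀ p m, B (N p) (NM m) = ext 1 NM (B (N p) m + B p (NM m) - ext 1 NM (B p m))) :
    IsNijenhuisPair Bh (map R N) (map R NM) := by
  have bilinear_identity : Bh.compl₁₂ (map R N) (map R NM) =
      (Bh ∘ₗ map R N + Bh.compl₂ (map R NM) - Bh.compr₂ (map R NM)).compr₂ (map R NM) := by
    refine hom_ext fun s p => hom_ext fun t m => ?_
    simp only [LinearMap.compl₁₂_apply, LinearMap.compr₂_apply, LinearMap.compl₂_apply,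
      LinearMap.comp_apply, LinearMap.add_apply, LinearMap.sub_apply, map_of, hB s t, h, eval_ext,
      map_add, map_sub]
  exact LinearMap.congr_fun₂ bilinear_identity

theorem comp_map (hB : Induces B Bh) (N : A →ₗ[DRing] A) :
    Induces (fun p m => B (N p) m) (Bh ∘ₗ map R N) := fun s t p m => by
  rw [LinearMap.comp_apply, map_of, hB]

end Induces

end Brackets

section Lie

open CurrentModule

variable {R : Type*} [CommRing R] [Algebra ℂ R]
variable {L : Type u} [AddCommGroup L] [Module ℂ L] [Module DRing L]
  [IsScalarTower ℂ DRing L] [LieConformalAlgebra L]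
variable {M : Type v} [AddCommGroup M] [Module ℂ M] [Module DRing M] [IsScalarTower ℂ DRing M]
variable {b : CurrentModule R L →ₗ[R] CurrentModule R L →ₗ[R] CurrentModule R L}
  {B : CurrentModule R L →ₗ[R] CurrentModule R M →ₗ[R] CurrentModule R M}

namespace Induces

theorem skew (hb : Induces (br (L := L)) b) (x y : CurrentModule R L) : b x y = -b y x := by
  have bilinear_identity : b = -b.flip := by
    refine hom_ext fun s p => hom_ext fun t q => ?_
    rw [LinearMap.neg_apply, LinearMap.neg_apply, LinearMap.flip_apply, hb, hb, br,
      LieConformalAlgebra.skew, map_neg]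
    refine congrArg _ (eval_subst _ (Fin.forall_fin_one.2 ?_) ?_ _) <;> simp [add_comm]
  exact LinearMap.congr_fun₂ bilinear_identity x y

theorem rep (hb : Induces (br (L := L)) b) {ρ : ConformalRep L M}
    (hB : Induces (fun p m => ρ.act p m) B) (x y : CurrentModule R L) (w : CurrentModule R M) :
    B (b x y) w = B x (B y w) - B y (B x w) := by
  let BB : CurrentModule R L →ₗ[R] CurrentModule R L →ₗ[R]
      CurrentModule R M →ₗ[R] CurrentModule R M :=
    (LinearMap.mul R (Module.End R (CurrentModule R M))).compl₁₂ B B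
  have trilinear_identity : b.compr₂ B + BB.flip = BB := by
    refine hom_ext fun s p => hom_ext fun t q => hom_ext fun z m => ?_
    let φ : LamRing 2 →ₐ[ℂ] R := lamHom ![s, t] (s + t + z)
    have h := congrArg (eval φ) (ρ.comm p q m)
    rw [map_sub, hB.eval_opComp (lamHom ![s] (s + t)) _ _ _ (by simp [φ]) (by simp [φ]),
      hB.eval_opAct (lamHom ![t] (t + z)) _ _ (Fin.forall_fin_one.2 (by simp [φ]))
        (by simp [φ]; ring),
      hB.eval_opAct (lamHom ![s] (s + z)) _ _ (Fin.forall_fin_one.2 (by simp [φ]))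
        (by simp [φ]; ring), ← hb, ← hB, ← hB] at h
    simpa [φ, BB, ← eq_sub_iff_add_eq] using h
  exact eq_sub_of_add_eq (LinearMap.congr_fun (LinearMap.congr_fun₂ trilinear_identity x y) w)

theorem isLieRep (hb : Induces (br (L := L)) b) {ρ : ConformalRep L M}
    (hB : Induces (fun p m => ρ.act p m) B) : IsLieRep b B where
  skew := hb.skew
  jacobi := hb.rep (ρ := adjoint L) hb
  rep := hb.rep hB

theorem deformed (hb : Induces (br (L := L)) b) (N : L →ₗ[DRing] L) :
    Induces (brN N) (deformed b (map R N)) := fun s t p q => by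
  rw [deformed_apply, map_of, map_of, hb, hb, hb, brN, map_sub, map_add, eval_ext]

end Induces

end Lie

section Multilinear

variable {R : Type*} [CommRing R]

theorem map_eq_zero_of_domDomCongr_swap [Invertible (2 : R)] {ι V W : Type*} [DecidableEq ι]
    [AddCommGroup V] [Module R V] [AddCommGroup W] [Module R W]
    {G : MultilinearMap R (fun _ : ι => V) W} {i j : ι} (h : G.domDomCongr (Equiv.swap i j) = -G)
    {v : ι → V} (hv : v i = v j) : G v = 0 := by
  have swap_args : (fun a => v (Equiv.swap i j a)) = v := by
    funext a
    rw [Equiv.swap_apply_def]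
    split_ifs with hi hj
    · rw [hi, hv]
    · rw [hj, hv]
    · rfl
  have eq_neg : G v = -G v := by simpa [swap_args] using congrArg (fun G => G v) h
  rw [← invOf_smul_smul (2 : R) (G v), two_smul, eq_neg_iff_add_eq_zero.1 eq_neg, smul_zero]

namespace CurrentModule

variable [Algebra ℂ R] {A : Type u} [AddCommGroup A] [Module DRing A]
variable {W : Type*} [AddCommGroup W] [Module R W] {n : ℕ}

theorem multilinearMap_ext {F G : MultilinearMap R (fun _ : Fin n => CurrentModule R A) W}
    (h : ∀ (s : Fin n → R) (p : Fin n → A),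
      F (fun i => of (s i) (p i)) = G (fun i => of (s i) (p i))) : F = G := by
  induction n with
  | zero =>
    ext v
    rw [Subsingleton.elim v fun i => of (Fin.elim0 i : R) (Fin.elim0 i : A)]
    exact h _ _
  | succ n ih =>
    have curryLeft_eq : F.curryLeft = G.curryLeft := by
      refine hom_ext fun z m => ih fun s p => ?_
      have := h (Fin.cons z s) (Fin.cons m p)
      simp only [MultilinearMap.curryLeft_apply]
      convert this using 2 <;> exact funext (Fin.cases rfl fun _ => rfl)
    rw [← F.uncurry_curryLeft, curryLeft_eq, G.uncurry_curryLeft]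

theorem exists_multilinearMap (F : (Fin n → R) → (Fin n → A) → W)
    (h : ∀ s p i, IsCompatible fun z m => F (Function.update s i z) (Function.update p i m)) :
    ∃ G : MultilinearMap R (fun _ : Fin n => CurrentModule R A) W,
      ∀ s p, G (fun i => of (s i) (p i)) = F s p := by
  induction n with
  | zero =>
    refine ⟨MultilinearMap.constOfIsEmpty R _ (F Fin.elim0 Fin.elim0), fun s p => ?_⟩
    rw [Subsingleton.elim s Fin.elim0, Subsingleton.elim p Fin.elim0]
    rfl
  | succ n ih =>
    have exists_tail (z : R) (m : A) :
        ∃ G : MultilinearMap R (fun _ : Fin n => CurrentModule R A) W,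
          ∀ s p, G (fun i => of (s i) (p i)) = F (Fin.cons z s) (Fin.cons m p) :=
      ih (fun s p => F (Fin.cons z s) (Fin.cons m p)) fun s p i => by
        simpa only [Fin.cons_update] using h (Fin.cons z s) (Fin.cons m p) i.succ
    choose G hG using exists_tail
    have compatible_head (s : Fin n → R) (p : Fin n → A) :
        IsCompatible fun z m => F (Fin.cons z s) (Fin.cons m p) := by
      simpa only [Fin.update_cons_zero] using h (Fin.cons 0 s) (Fin.cons 0 p) 0
    have compatible : IsCompatible G := by
      refine ⟨fun z m m' => ?_, fun z P m => ?_⟩ <;> refine multilinearMap_ext fun s p => ?_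
      · simp only [add_apply, hG, (compatible_head s p).map_add]
      · simp only [smul_apply, hG, (compatible_head s p).map_smul]
    refine ⟨LinearMap.uncurryLeft (M := fun _ : Fin (n + 1) => CurrentModule R A)
      compatible.lift, fun s p => ?_⟩
    rw [LinearMap.uncurryLeft_apply, compatible.lift_of]
    refine (hG _ _ (Fin.tail s) (Fin.tail p)).trans ?_
    rw [Fin.cons_self_tail, Fin.cons_self_tail]

end CurrentModule

end Multilinear

section Extension

open CurrentModule

variable {R : Type*} [CommRing R] [Algebra ℂ R]

noncomputable instance invertibleTwoOfComplexAlgebra : Invertible (2 : R) :=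
  (Invertible.map (algebraMap ℂ R) 2).copy 2 (map_ofNat _ 2).symm

/-- The homomorphism with `λᵢ ↦ sᵢ`, also for the last variable `λₖ₊₁ = -∂ - λ₁ - ⋯ - λₖ`. -/
noncomputable def argHom {k : ℕ} (s : Fin (k + 1) → R) : LamRing k →ₐ[ℂ] R :=
  lamHom (fun i => s i.castSucc) (∑ i, s i)

section argHom

variable {k : ℕ} (s : Fin (k + 1) → R)

@[simp] theorem argHom_lv (i : Fin k) : argHom s (lv i) = s i.castSucc :=
  lamHom_lv _ _ i

@[simp] theorem argHom_del : argHom s (del k) = -∑ i, s i :=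
  lamHom_del _ _

@[simp] theorem argHom_lam (i : Fin (k + 1)) : argHom s (lam k i) = s i := by
  induction i using Fin.lastCases with
  | last => simp [lam, Fin.sum_univ_castSucc]
  | cast i => simp [lam]

theorem sum_lam (k : ℕ) : ∑ i, lam k i = -del k := by
  simp [lam, Fin.sum_univ_castSucc]

theorem argHom_lam_eq_id (k : ℕ) : argHom (lam k) = AlgHom.id ℂ (LamRing k) :=
  lamRing_hom_ext (fun i => by simp [lam]) (by simp [sum_lam])

end argHom

theorem eval_evalAt {L : Type u} {M : Type v} [AddCommGroup M] [Module DRing M] {k l : ℕ}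
    {φ : LamRing l →ₐ[ℂ] R} (f : (Fin (k + 1) → L) → LamPoly k M) {μ : Fin (k + 1) → LamRing l}
    {s : Fin (k + 1) → R} (hμ : ∀ i, φ (μ i) = s i) (hdel : φ (del l) = -∑ i, s i)
    (p : Fin (k + 1) → L) : eval φ (evalAt f μ p) = eval (argHom s) (f p) :=
  eval_subst _ (fun i => by rw [hμ, argHom_lv]) (by rw [hdel, argHom_del]) _

variable {L : Type u} [AddCommGroup L] [Module DRing L]
variable {M : Type v} [AddCommGroup M] [Module DRing M]

theorem IsCochain.domDomCongr_eq [Module ℂ L] {k : ℕ} {f : (Fin (k + 1) → L) → LamPoly k M}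
    (hf : IsCochain f)
    {G : MultilinearMap R (fun _ : Fin (k + 1) => CurrentModule R L) (CurrentModule R M)}
    (hG : ∀ s p, G (fun i => of (s i) (p i)) = eval (argHom s) (f p))
    (τ : Equiv.Perm (Fin (k + 1))) :
    G.domDomCongr τ = ((Equiv.Perm.sign τ : ℤˣ) : ℤ) • G := by
  refine multilinearMap_ext fun s p => ?_
  have skew := congrArg (eval (argHom s)) (hf.skew τ p)
  rw [eval_evalAt f (μ := lam k ∘ τ) (s := s ∘ τ) (fun i => argHom_lam s (τ i))
    (by rw [argHom_del, ← Equiv.sum_comp τ s]; rfl), map_zsmul] at skew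
  rw [MultilinearMap.domDomCongr_apply, smul_apply, hG s p]
  exact (hG (s ∘ τ) (p ∘ τ)).trans skew

theorem IsCochain.exists_multilinearMap [Module ℂ L] [IsScalarTower ℂ DRing L] {k : ℕ}
    {f : (Fin (k + 1) → L) → LamPoly k M} (hf : IsCochain f) :
    ∃ G : MultilinearMap R (fun _ : Fin (k + 1) => CurrentModule R L) (CurrentModule R M),
      ∀ s p, G (fun i => of (s i) (p i)) = eval (argHom s) (f p) := by
  refine CurrentModule.exists_multilinearMap (fun s p => eval (argHom s) (f p)) fun s p i =>
    .of_map_X_smul (fun z m m' => ?_) (fun z c m => ?_) fun z m => ?_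
  · rw [hf.map_add, _root_.map_add]
  · rw [hf.map_smul, eval_complex_smul]
  · have sesq := hf.sesq (Function.update p i m) i
    rw [Function.update_self, Function.update_idem] at sesq
    rw [sesq, map_neg, eval_smul, argHom_lam, Function.update_self]

variable [Module ℂ M] [IsScalarTower ℂ DRing M]

/-- Evaluation of the values of `n`-cochains at `λᵢ = sᵢ`. The results lie in the summand of index
`∑ i, sᵢ`; for `n = 0` this is the summand of index `0`, on which `∂` acts by `0`. -/
noncomputable def evalCochVal : ∀ {n : ℕ}, (Fin n → R) → CochVal M n →+ CurrentModule R M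
  | 0, _ => (QuotientAddGroup.lift (delRange M).toAddSubgroup (of (0 : R)) (by
      rintro _ ⟨m, rfl⟩
      change of 0 ((Polynomial.X : DRing) • m) = 0
      rw [of_smul, Polynomial.aeval_X, neg_zero, zero_smul]) :
      M ⧸ (delRange M).toAddSubgroup →+ CurrentModule R M)
  | _ + 1, s => eval (argHom s)

theorem CurrentModule.of_complex_smul (z : R) (c : ℂ) (m : M) :
    of z (c • m) = algebraMap ℂ R c • of z m := by
  rw [← algebraMap_smul DRing c m, of_smul, Polynomial.algebraMap_eq, Polynomial.aeval_C]

theorem evalCochVal_smul {n : ℕ} (s : Fin n → R) (c : ℂ) (v : CochVal M n) :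
    evalCochVal s (c • v) = algebraMap ℂ R c • evalCochVal s v := by
  cases n with
  | zero =>
    obtain ⟨m, rfl⟩ := (delRange M).mkQ_surjective v
    exact of_complex_smul 0 c m
  | succ k => exact eval_complex_smul (M := M) _ c v

/-- The alternating map `F` on `CurrentModule R L` is the extension of the cochain `f`. -/
def Extends {n : ℕ} (F : CurrentModule R L [⋀^Fin n]→ₗ[R] CurrentModule R M)
    (f : RawCochain L M n) : Prop :=
  ∀ (s : Fin n → R) (p : Fin n → L), F (fun i => of (s i) (p i)) = evalCochVal s (f p)

namespace Extends

section Recover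

variable {k : ℕ} {F : CurrentModule (LamRing k) L [⋀^Fin (k + 1)]→ₗ[LamRing k]
    CurrentModule (LamRing k) M}

theorem eval_id {f : (Fin (k + 1) → L) → LamPoly k M} (h : Extends (n := k + 1) F f)
    (p : Fin (k + 1) → L) :
    eval (AlgHom.id ℂ (LamRing k)) (f p) = F fun i => of (lam k i) (p i) := by
  rw [← argHom_lam_eq_id]
  exact (h _ p).symm

theorem eval_id_update {f : (Fin (k + 1) → L) → LamPoly k M} (h : Extends (n := k + 1) F f)
    (p : Fin (k + 1) → L) (i : Fin (k + 1)) (x : L) :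
    eval (AlgHom.id ℂ (LamRing k)) (f (Function.update p i x)) =
      F (Function.update (fun j => of (lam k j) (p j)) i (of (lam k i) x)) := by
  rw [h.eval_id]
  refine congrArg F (funext fun j => ?_)
  rcases eq_or_ne j i with rfl | hj
  · simp
  · simp [hj]

theorem unique {f g : RawCochain L M (k + 1)} (hf : Extends F f) (hg : Extends F g) : f = g :=
  funext fun p => eval_id_injective ((eval_id hf p).trans (eval_id hg p).symm)

end Recover

variable {n : ℕ} {F G : CurrentModule R L [⋀^Fin n]→ₗ[R] CurrentModule R M}
  {f g : RawCochain L M n}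

theorem add (hF : Extends F f) (hG : Extends G g) : Extends (F + G) (f + g) := fun s p => by
  rw [AlternatingMap.add_apply, Pi.add_apply, map_add, hF, hG]

theorem zsmul (hF : Extends F f) (c : ℤ) : Extends (c • F) (c • f) := fun s p => by
  rw [AlternatingMap.smul_apply, Pi.smul_apply, map_zsmul, hF]

theorem complex_smul (hF : Extends F f) (c : ℂ) : Extends (algebraMap ℂ R c • F) (c • f) :=
  fun s p => by rw [AlternatingMap.smul_apply, Pi.smul_apply, evalCochVal_smul, hF]

theorem zero : Extends (0 : CurrentModule R L [⋀^Fin n]→ₗ[R] CurrentModule R M) 0 := fun s p => by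
  rw [AlternatingMap.zero_apply, Pi.zero_apply, map_zero]

end Extends

variable [Module ℂ L] [IsScalarTower ℂ DRing L]

theorem exists_extends {n : ℕ} {f : RawCochain L M n} (hf : f ∈ cochains L M n) :
    ∃ F : CurrentModule R L [⋀^Fin n]→ₗ[R] CurrentModule R M, Extends F f := by
  cases n with
  | zero =>
    refine ⟨AlternatingMap.constOfIsEmpty R _ _ (evalCochVal Fin.elim0 (f Fin.elim0)),
      fun s p => ?_⟩
    rw [Subsingleton.elim s Fin.elim0, Subsingleton.elim p Fin.elim0]
    rfl
  | succ k =>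
    have hf : IsCochain (M := M) f := hf
    obtain ⟨G, hG⟩ := hf.exists_multilinearMap (R := R)
    refine ⟨⟨G, fun v i j hv hij => map_eq_zero_of_domDomCongr_swap ?_ hv⟩, hG⟩
    simp [hf.domDomCongr_eq hG, Equiv.Perm.sign_swap hij]

theorem Extends.isCochain {k : ℕ} {F : CurrentModule (LamRing k) L [⋀^Fin (k + 1)]→ₗ[LamRing k]
    CurrentModule (LamRing k) M} {f : (Fin (k + 1) → L) → LamPoly k M}
    (h : Extends (n := k + 1) F f) : IsCochain f := by
  refine ⟨fun p i x y => ?_, fun p i c x => ?_, fun p i => ?_, fun τ p => ?_⟩ <;>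
    apply eval_id_injective
  · simp only [map_add, h.eval_id_update, F.map_update_add]
  · rw [eval_complex_smul, h.eval_id_update, h.eval_id_update, of_complex_smul,
      F.map_update_smul]
  · rw [map_neg, eval_smul, h.eval_id_update, of_smul, Polynomial.aeval_X,
      F.map_update_smul, neg_smul, Function.update_eq_self, ← h.eval_id]
    rfl
  · have sum_perm : ∑ i, (lam k ∘ τ) i = -del k := (Equiv.sum_comp τ (lam k)).trans (sum_lam k)
    rw [eval_evalAt f (μ := lam k ∘ τ) (s := lam k ∘ τ) (fun _ => rfl)
      (by rw [sum_perm, neg_neg]; rfl), map_zsmul, h.eval_id]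
    exact (h _ (p ∘ τ)).symm.trans (F.map_perm (fun i => of (lam k i) (p i)) τ)

end Extension

section Comparison

open CurrentModule

variable {R : Type*} [CommRing R] [Algebra ℂ R]
variable {L : Type u} [AddCommGroup L] [Module DRing L]
variable {M : Type v} [AddCommGroup M] [Module ℂ M] [Module DRing M] [IsScalarTower ℂ DRing M]

theorem eval_ceSum_bracket {b : L → L → LamPoly 1 L}
    {bh : CurrentModule R L →ₗ[R] CurrentModule R L →ₗ[R] CurrentModule R L} (hb : Induces b bh)
    {k : ℕ} {F : CurrentModule R L [⋀^Fin (k + 1)]→ₗ[R] CurrentModule R M}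
    {f : (Fin (k + 1) → L) → LamPoly k M} (hF : Extends (n := k + 1) F f) (s : Fin (k + 2) → R)
    (p : Fin (k + 2) → L) {i : Fin (k + 1)} {j : Fin (k + 2)} (hij : i.castSucc < j) :
    eval (argHom s)
        (evalWith ![lam (k + 1) i.castSucc]
          (fun c => evalAt f
            (Fin.cons (lam (k + 1) i.castSucc + lam (k + 1) j)
              fun a => lam (k + 1) (j.succAbove (i.succAbove a)))
            (Fin.cons c fun a => p (j.succAbove (i.succAbove a))))
          (b (p i.castSucc) (p j))) =
      F (Fin.cons (bh (of (s i.castSucc) (p i.castSucc)) (of (s j) (p j)))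
        (i.removeNth (j.removeNth fun a => of (s a) (p a)))) := by
  let w : Fin k → CurrentModule R L := i.removeNth (j.removeNth fun a => of (s a) (p a))
  let insertHead : CurrentModule R L →ₗ[R] CurrentModule R M :=
    { toFun := fun x => F (Fin.cons x w)
      map_add' := F.toMultilinearMap.cons_add w
      map_smul' := F.toMultilinearMap.cons_smul w }
  let s' : Fin (k + 1) → R := Fin.cons (s i.castSucc + s j) (i.removeNth (j.removeNth s))
  have sum_eq : ∑ a, s' a = ∑ a, s a := by
    rw [Fin.sum_univ_succ, Fin.sum_univ_succAbove s j,
      Fin.sum_univ_succAbove (fun a => s (j.succAbove a)) i,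
      Fin.succAbove_of_castSucc_lt _ _ hij]
    simp only [s', Fin.cons_zero, Fin.cons_succ, Fin.removeNth]
    ring
  rw [hb]
  refine eval_evalWith _ (Fin.forall_fin_one.2 ?_) insertHead (fun c => ?_) _
  · simp
  · rw [eval_evalAt f (s := s') (Fin.cases ?_ fun a => ?_) (by rw [argHom_del, sum_eq])]
    · refine (hF s' _).symm.trans (congrArg F (funext (Fin.cases ?_ fun _ => rfl)))
      simp [s']
    · simp [s']
    · simp [s', Fin.removeNth]

theorem Extends.ceSum {b : L → L → LamPoly 1 L} {B : L → M → LamPoly 1 M}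
    {bh : CurrentModule R L →ₗ[R] CurrentModule R L →ₗ[R] CurrentModule R L}
    {Bh : CurrentModule R L →ₗ[R] CurrentModule R M →ₗ[R] CurrentModule R M}
    (hb : Induces b bh) (skew : ∀ x y, bh x y = -bh y x) (hB : Induces B Bh) {k : ℕ}
    {F : CurrentModule R L [⋀^Fin (k + 1)]→ₗ[R] CurrentModule R M}
    {f : (Fin (k + 1) → L) → LamPoly k M} (hF : Extends (n := k + 1) F f) :
    Extends (n := k + 2) (chevalleyEilenberg bh Bh F) (NijLCA.ceSum b B f) := by
  intro s p
  rw [chevalleyEilenberg_apply_succ skew]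
  refine Eq.trans ?_ (map_add (eval (M := M) (argHom s)) _ _).symm
  rw [map_sum, map_sum]
  congr 1
  · refine Finset.sum_congr rfl fun i _ => ?_
    rw [map_zsmul, hB.eval_opAct (argHom (i.removeNth s)) _ _ (fun a => ?_) ?_, argHom_lam]
    · exact congrArg (fun y => _ • Bh _ y) (hF (i.removeNth s) (i.removeNth p))
    · rw [argHom_del, argHom_lam, argHom_del, Fin.sum_univ_succAbove s i, neg_add_rev,
        neg_add_cancel_right]
      rfl
    · rw [argHom_lam, argHom_lv]
      rfl
  · refine Finset.sum_congr rfl fun j _ => ?_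
    rw [map_sum]
    refine Finset.sum_congr rfl fun i _ => ?_
    split_ifs with hij
    · rw [map_zsmul, eval_ceSum_bracket hb hF s p hij]
    · rw [map_zero]

theorem Extends.sub_postcomp {k : ℕ}
    {F G : CurrentModule R L [⋀^Fin (k + 1)]→ₗ[R] CurrentModule R M}
    {f g : (Fin (k + 1) → L) → LamPoly k M} (hF : Extends (n := k + 1) F f)
    (hG : Extends (n := k + 1) G g) (T : M →ₗ[DRing] M) :
    Extends (n := k + 1) (F - postcomp (map R T) G)
      fun p => (f p - ext k T (g p) : LamPoly k M) := fun s p => by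
  refine Eq.trans ?_ (map_sub (eval (M := M) (argHom s)) _ _).symm
  rw [AlternatingMap.sub_apply, postcomp_apply, hF, hG, eval_ext]
  rfl

theorem Extends.rawXi (N : L →ₗ[DRing] L) (NM : M →ₗ[DRing] M) {n : ℕ}
    {F : CurrentModule R L [⋀^Fin n]→ₗ[R] CurrentModule R M} {f : RawCochain L M n}
    (hF : Extends F f) : Extends (xi (map R N) (map R NM) F) (NijLCA.rawXi N NM n f) := by
  cases n with
  | zero => rwa [xi_zero_degree]
  | succ k =>
    intro s p
    have eval_term (S : Finset (Fin (k + 1))) :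
        eval (M := M) (argHom s)
            (ext k (NM ^ S.card) (f fun i => if i ∈ S then p i else N (p i))) =
          (map R NM ^ S.card)
            (F fun i => if i ∈ S then of (s i) (p i) else map R N (of (s i) (p i))) := by
      refine (eval_ext _ _ _).trans ?_
      rw [CurrentModule.map_pow]
      refine congrArg _ ((hF s _).symm.trans (congrArg F (funext fun i => ?_)))
      split_ifs <;> simp only [map_of]
    rw [xi_apply]
    refine Eq.trans ?_ (map_sum (eval (M := M) (argHom s)) _ _).symm
    exact Finset.sum_congr rfl fun S _ =>
      (congrArg _ (eval_term S).symm).trans (map_zsmul (eval (M := M) (argHom s)) _ _).symm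

variable [Module ℂ L] [IsScalarTower ℂ DRing L] [LieConformalAlgebra L] {ρ : ConformalRep L M}
  {b : CurrentModule R L →ₗ[R] CurrentModule R L →ₗ[R] CurrentModule R L}
  {B : CurrentModule R L →ₗ[R] CurrentModule R M →ₗ[R] CurrentModule R M}

theorem evalCochVal_actZero {φ : L → L} (hB : Induces (fun p m => ρ.act (φ p) m) B)
    (s : Fin 1 → R) (t : Fin 0 → R) (p : L) (c : CochVal M 0) :
    evalCochVal (n := 1) s (actZero ρ (φ p) c) = B (of (s 0) p) (evalCochVal t c) := by
  obtain ⟨m, rfl⟩ := (delRange M).mkQ_surjective c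
  change eval _ (subst ![-del 0] (ρ.act (φ p) m)) = B (of (s 0) p) (of 0 m)
  rw [hB]
  exact eval_subst _ (Fin.forall_fin_one.2 (by simp)) (by simp) _

theorem Extends.actZero {φ : L → L} (hB : Induces (fun p m => ρ.act (φ p) m) B)
    (b : CurrentModule R L →ₗ[R] CurrentModule R L →ₗ[R] CurrentModule R L)
    {F : CurrentModule R L [⋀^Fin 0]→ₗ[R] CurrentModule R M} {f : RawCochain L M 0}
    (hF : Extends F f) :
    Extends (n := 1) (chevalleyEilenberg b B F)
      fun p => NijLCA.actZero ρ (φ (p 0)) (f Fin.elim0) := fun s p => by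
  rw [evalCochVal_actZero hB s Fin.elim0, ← hF, chevalleyEilenberg_apply_zero]
  exact congrArg _ (congrArg F (Subsingleton.elim _ _))

theorem Extends.rawDelta (hb : Induces (br (L := L)) b) (hB : Induces (fun p m => ρ.act p m) B)
    {n : ℕ} {F : CurrentModule R L [⋀^Fin n]→ₗ[R] CurrentModule R M} {f : RawCochain L M n}
    (hF : Extends F f) : Extends (chevalleyEilenberg b B F) (NijLCA.rawDelta ρ n f) := by
  cases n with
  | zero => exact hF.actZero (φ := id) hB b
  | succ k => exact hF.ceSum hb hb.skew hB

theorem Extends.rawDN (hb : Induces (br (L := L)) b) (hB : Induces (fun p m => ρ.act p m) B)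
    (N : L →ₗ[DRing] L) (NM : M →ₗ[DRing] M) {n : ℕ}
    {F : CurrentModule R L [⋀^Fin n]→ₗ[R] CurrentModule R M} {f : RawCochain L M n}
    (hF : Extends F f) :
    Extends (nijenhuisDifferential b B (map R N) (map R NM) F) (NijLCA.rawDN N ρ NM n f) := by
  have hδ := hF.rawDelta hb hB
  cases n with
  | zero => exact (hF.actZero (hB.comp_map N) _).sub_postcomp hδ NM
  | succ k =>
    exact (hF.ceSum (hb.deformed N) (deformed_skew hb.skew) (hB.comp_map N)).sub_postcomp hδ NM

end Comparison

section LinearOnSubmodules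

variable {S : Type*} [Ring S] {A A' : Type*} [AddCommGroup A] [Module S A] [AddCommGroup A']
  [Module S A'] {G : Submodule S A} {H : Submodule S A'}

/-- `T` restricts to a linear map from `G` to `H`. The map `T` need not be linear, or even
additive, outside `G`. -/
structure MapsLinearly (T : A → A') (G : Submodule S A) (H : Submodule S A') : Prop where
  mem : ∀ x ∈ G, T x ∈ H
  map_add : ∀ x ∈ G, ∀ y ∈ G, T (x + y) = T x + T y
  map_smul : ∀ (c : S), ∀ x ∈ G, T (c • x) = c • T x

namespace MapsLinearly

variable {T T' : A → A'}

theorem map_zsmul (hT : MapsLinearly T G H) (c : ℤ) {x : A} (hx : x ∈ G) :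
    T (c • x) = c • T x := by
  rw [← Int.cast_smul_eq_zsmul S, hT.map_smul c x hx, Int.cast_smul_eq_zsmul]

theorem add (hT : MapsLinearly T G H) (hT' : MapsLinearly T' G H) :
    MapsLinearly (fun x => T x + T' x) G H where
  mem x hx := H.add_mem (hT.mem x hx) (hT'.mem x hx)
  map_add x hx y hy := by
    rw [hT.map_add x hx y hy, hT'.map_add x hx y hy, add_add_add_comm]
  map_smul c x hx := by rw [hT.map_smul c x hx, hT'.map_smul c x hx, smul_add]

theorem zsmul (hT : MapsLinearly T G H) (c : ℤ) : MapsLinearly (fun x => c • T x) G H where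
  mem x hx := zsmul_mem (hT.mem x hx) c
  map_add x hx y hy := by rw [hT.map_add x hx y hy, smul_add]
  map_smul a x hx := by rw [hT.map_smul a x hx, smul_comm]

theorem prodMk {A'' : Type*} [AddCommGroup A''] [Module S A''] {H' : Submodule S A''}
    {U : A → A''} (hT : MapsLinearly T G H) (hU : MapsLinearly U G H') :
    MapsLinearly (fun x => (T x, U x)) G (H.prod H') where
  mem x hx := ⟨hT.mem x hx, hU.mem x hx⟩
  map_add x hx y hy := Prod.ext (hT.map_add x hx y hy) (hU.map_add x hx y hy)
  map_smul c x hx := Prod.ext (hT.map_smul c x hx) (hU.map_smul c x hx)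

theorem comp_linearMap {A'' : Type*} [AddCommGroup A''] [Module S A''] {K : Submodule S A''}
    (hT : MapsLinearly T G H) (φ : A'' →ₗ[S] A) (hφ : K ≤ G.comap φ) :
    MapsLinearly (fun x => T (φ x)) K H where
  mem x hx := hT.mem _ (hφ hx)
  map_add x hx y hy := by rw [_root_.map_add, hT.map_add _ (hφ hx) _ (hφ hy)]
  map_smul c x hx := by rw [_root_.map_smul, hT.map_smul c _ (hφ hx)]

theorem mono (hT : MapsLinearly T G H) {K : Submodule S A} (hK : K ≤ G) : MapsLinearly T K H :=
  hT.comp_linearMap LinearMap.id hK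

end MapsLinearly

theorem formsCochainComplex_of_mapsLinearly {A : ℕ → Type v} [∀ n, AddCommGroup (A n)]
    [∀ n, Module ℂ (A n)] {G : ∀ n, Submodule ℂ (A n)} {D : ∀ n, A n → A (n + 1)}
    (hD : ∀ n, MapsLinearly (D n) (G n) (G (n + 1)))
    (sq_zero : ∀ n, ∀ x ∈ G n, D (n + 1) (D n x) = 0) : FormsCochainComplex G D :=
  ⟨fun n =>
    { toFun := fun x => ⟨D n x, (hD n).mem x x.2⟩
      map_add' := fun x y => Subtype.ext ((hD n).map_add x x.2 y y.2)
      map_smul' := fun c x => Subtype.ext ((hD n).map_smul c x x.2) },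
    fun _ _ => rfl, fun n => LinearMap.ext fun x => Subtype.ext (sq_zero n x x.2)⟩

end LinearOnSubmodules

section Complex

open CurrentModule

variable {L : Type u} [AddCommGroup L] [Module ℂ L] [Module DRing L]
variable {M : Type v} [AddCommGroup M] [Module ℂ M] [Module DRing M] [IsScalarTower ℂ DRing M]

theorem nlCochainsFull_le_comap_fst (n : ℕ) :
    nlCochainsFull L M n ≤
      (cochains L M n).comap (LinearMap.fst ℂ (RawCochain L M n) (RawCochain L M (n - 1))) := by
  cases n with
  | zero => exact fun _ _ => trivial
  | succ n => exact fun _ hx => hx.1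

theorem nlCochains_le_nlCochainsFull (n : ℕ) : nlCochains L M n ≤ nlCochainsFull L M (n + 1) := by
  cases n with
  | zero => exact Submodule.prod_mono le_rfl bot_le
  | succ n => exact le_rfl

variable [IsScalarTower ℂ DRing L]

theorem mapsLinearly_of_extends {m n : ℕ} {T : RawCochain L M m → RawCochain L M (n + 1)}
    (Th : (CurrentModule (LamRing n) L [⋀^Fin m]→ₗ[LamRing n] CurrentModule (LamRing n) M)
      →ₗ[LamRing n]
        CurrentModule (LamRing n) L [⋀^Fin (n + 1)]→ₗ[LamRing n] CurrentModule (LamRing n) M)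
    (hT : ∀ {F f}, Extends F f → Extends (Th F) (T f)) :
    MapsLinearly T (cochains L M m) (cochains L M (n + 1)) := by
  refine ⟨fun f hf => ?_, fun f hf g hg => ?_, fun c f hf => ?_⟩
  · obtain ⟨F, hF⟩ := exists_extends (R := LamRing n) hf
    exact (hT hF).isCochain
  · obtain ⟨F, hF⟩ := exists_extends (R := LamRing n) hf
    obtain ⟨G, hG⟩ := exists_extends (R := LamRing n) hg
    have h := hT (hF.add hG)
    rw [map_add] at h
    exact h.unique ((hT hF).add (hT hG))
  · obtain ⟨F, hF⟩ := exists_extends (R := LamRing n) hf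
    have h := hT (hF.complex_smul c)
    rw [map_smul] at h
    exact h.unique ((hT hF).complex_smul c)

theorem mapsLinearly_rawXi (N : L →ₗ[DRing] L) (NM : M →ₗ[DRing] M) (n : ℕ) :
    MapsLinearly (rawXi N NM n) (cochains L M n) (cochains L M n) := by
  cases n with
  | zero => exact ⟨fun _ h => h, fun _ _ _ _ => rfl, fun _ _ _ => rfl⟩
  | succ k => exact mapsLinearly_of_extends (xi (map _ N) (map _ NM)) fun hF => hF.rawXi N NM

variable [LieConformalAlgebra L]

theorem exists_induces_br (L : Type u) [AddCommGroup L] [Module ℂ L] [Module DRing L]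
    [IsScalarTower ℂ DRing L] [LieConformalAlgebra L] (R : Type*) [CommRing R] [Algebra ℂ R] :
    ∃ b : CurrentModule R L →ₗ[R] CurrentModule R L →ₗ[R] CurrentModule R L,
      Induces (br (L := L)) b :=
  exists_induces LieConformalAlgebra.bracket LieConformalAlgebra.del_left
    LieConformalAlgebra.del_right

theorem exists_induces_act (ρ : ConformalRep L M) (R : Type*) [CommRing R] [Algebra ℂ R] :
    ∃ B : CurrentModule R L →ₗ[R] CurrentModule R M →ₗ[R] CurrentModule R M,
      Induces (fun p m => ρ.act p m) B :=
  exists_induces ρ.act ρ.del_left ρ.del_right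

variable {N : L →ₗ[DRing] L} {ρ : ConformalRep L M} {NM : M →ₗ[DRing] M} {n : ℕ}

theorem mapsLinearly_rawDelta (ρ : ConformalRep L M) (n : ℕ) :
    MapsLinearly (rawDelta ρ n) (cochains L M n) (cochains L M (n + 1)) := by
  obtain ⟨b, hb⟩ := exists_induces_br L (LamRing n)
  obtain ⟨B, hB⟩ := exists_induces_act ρ (LamRing n)
  exact mapsLinearly_of_extends (chevalleyEilenberg b B) fun hF => hF.rawDelta hb hB

theorem mapsLinearly_rawDN (N : L →ₗ[DRing] L) (ρ : ConformalRep L M) (NM : M →ₗ[DRing] M)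
    (n : ℕ) : MapsLinearly (rawDN N ρ NM n) (cochains L M n) (cochains L M (n + 1)) := by
  obtain ⟨b, hb⟩ := exists_induces_br L (LamRing n)
  obtain ⟨B, hB⟩ := exists_induces_act ρ (LamRing n)
  exact mapsLinearly_of_extends (nijenhuisDifferential b B (map _ N) (map _ NM))
    fun hF => hF.rawDN hb hB N NM

theorem rawDelta_rawDelta {f : RawCochain L M n} (hf : f ∈ cochains L M n) :
    rawDelta ρ (n + 1) (rawDelta ρ n f) = 0 := by
  obtain ⟨b, hb⟩ := exists_induces_br L (LamRing (n + 1))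
  obtain ⟨B, hB⟩ := exists_induces_act ρ (LamRing (n + 1))
  obtain ⟨F, hF⟩ := exists_extends (R := LamRing (n + 1)) hf
  have h := (hF.rawDelta hb hB).rawDelta hb hB
  rw [(hb.isLieRep hB).chevalleyEilenberg_chevalleyEilenberg] at h
  exact h.unique .zero

theorem rawDN_rawDN (hN : IsNijenhuis N) (hρ : IsNijenhuisRep N ρ NM) {f : RawCochain L M n}
    (hf : f ∈ cochains L M n) : rawDN N ρ NM (n + 1) (rawDN N ρ NM n f) = 0 := by
  obtain ⟨b, hb⟩ := exists_induces_br L (LamRing (n + 1))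
  obtain ⟨B, hB⟩ := exists_induces_act ρ (LamRing (n + 1))
  obtain ⟨F, hF⟩ := exists_extends (R := LamRing (n + 1)) hf
  have h := (hF.rawDN hb hB N NM).rawDN hb hB N NM
  rw [nijenhuisDifferential_nijenhuisDifferential (hb.isLieRep hB) (hb.isNijenhuisPair hN)
    (hB.isNijenhuisPair hρ)] at h
  exact h.unique .zero

theorem rawXi_rawDelta (hN : IsNijenhuis N) (hρ : IsNijenhuisRep N ρ NM) {f : RawCochain L M n}
    (hf : f ∈ cochains L M n) :
    rawXi N NM (n + 1) (rawDelta ρ n f) = rawDN N ρ NM n (rawXi N NM n f) := by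
  obtain ⟨b, hb⟩ := exists_induces_br L (LamRing n)
  obtain ⟨B, hB⟩ := exists_induces_act ρ (LamRing n)
  obtain ⟨F, hF⟩ := exists_extends (R := LamRing n) hf
  have h := (hF.rawDelta hb hB).rawXi N NM
  rw [xi_chevalleyEilenberg hb.skew (hb.isNijenhuisPair hN) (hB.isNijenhuisPair hρ)] at h
  exact h.unique ((hF.rawXi N NM).rawDN hb hB N NM)

theorem mapsLinearly_rawDNL (N : L →ₗ[DRing] L) (ρ : ConformalRep L M) (NM : M →ₗ[DRing] M)
    (n : ℕ) :
    MapsLinearly (rawDNL N ρ NM n) (nlCochainsFull L M n) (nlCochainsFull L M (n + 1)) := by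
  have hδ := (mapsLinearly_rawDelta ρ n).comp_linearMap _ (nlCochainsFull_le_comap_fst n)
  have hξ := (mapsLinearly_rawXi N NM n).comp_linearMap _ (nlCochainsFull_le_comap_fst n)
  cases n with
  | zero => exact hδ.prodMk hξ
  | succ n =>
    have hd := (mapsLinearly_rawDN N ρ NM n).comp_linearMap (K := nlCochainsFull L M (n + 1))
      (LinearMap.snd ℂ (RawCochain L M (n + 1)) (RawCochain L M n)) fun _ hx => hx.2
    exact hδ.prodMk ((hξ.zsmul _).add hd)

theorem rawDNL_rawDNL (hN : IsNijenhuis N) (hρ : IsNijenhuisRep N ρ NM) (n : ℕ) :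
    ∀ x ∈ nlCochainsFull L M n, rawDNL N ρ NM (n + 1) (rawDNL N ρ NM n x) = 0 := by
  rintro ⟨f, g⟩ hx
  have hf : f ∈ cochains L M n := nlCochainsFull_le_comap_fst n hx
  have hδ := rawDelta_rawDelta (ρ := ρ) hf
  have hξ := rawXi_rawDelta hN hρ hf
  have hd := mapsLinearly_rawDN N ρ NM n
  cases n with
  | zero =>
    refine Prod.ext hδ ?_
    change (-1 : ℤ) ^ 1 • rawXi N NM 1 (rawDelta ρ 0 f) + rawDN N ρ NM 0 f = 0
    rw [hξ, pow_one, neg_one_smul]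
    exact neg_add_cancel _
  | succ n =>
    have hg : g ∈ cochains L M n := hx.2
    have hξf := (mapsLinearly_rawXi N NM (n + 1)).mem f hf
    refine Prod.ext hδ ?_
    change (-1 : ℤ) ^ (n + 2) • rawXi N NM (n + 2) (rawDelta ρ (n + 1) f) +
      rawDN N ρ NM (n + 1) ((-1 : ℤ) ^ (n + 1) • rawXi N NM (n + 1) f + rawDN N ρ NM n g) = 0
    rw [hd.map_add _ (zsmul_mem hξf _) _ ((mapsLinearly_rawDN N ρ NM n).mem g hg),
      rawDN_rawDN hN hρ hg, add_zero, hd.map_zsmul _ hξf, hξ, ← add_smul, pow_succ _ (n + 1),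
      mul_neg_one, neg_add_cancel, zero_smul]

theorem formsCochainComplex_nlCochainsFull (hN : IsNijenhuis N) (hρ : IsNijenhuisRep N ρ NM) :
    FormsCochainComplex (nlCochainsFull L M) (rawDNL N ρ NM) :=
  formsCochainComplex_of_mapsLinearly (mapsLinearly_rawDNL N ρ NM)
    (rawDNL_rawDNL hN hρ)

theorem formsCochainComplex_nlCochains (hN : IsNijenhuis N) (hρ : IsNijenhuisRep N ρ NM) :
    FormsCochainComplex (nlCochains L M) fun n => rawDNL N ρ NM (n + 1) :=
  formsCochainComplex_of_mapsLinearly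
    (fun n => (mapsLinearly_rawDNL N ρ NM (n + 1)).mono (nlCochains_le_nlCochainsFull n))
    fun n x hx => rawDNL_rawDNL hN hρ (n + 1) x (nlCochains_le_nlCochainsFull n hx)

end Complex

end NijLCA

theorem mainTheorem8 {L : Type*} [AddCommGroup L] [Module ℂ L] [Module NijLCA.DRing L]
    [IsScalarTower ℂ NijLCA.DRing L] [NijLCA.LieConformalAlgebra L]
    (N : L →ₗ[NijLCA.DRing] L) (hN : NijLCA.IsNijenhuis N) :
    (NijLCA.FormsCochainComplex (NijLCA.nlCochains L L)
        (fun n => NijLCA.rawDNL N (NijLCA.adjoint L) N (n + 1)) ∧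
      NijLCA.FormsCochainComplex (NijLCA.nlCochainsFull L L)
        (NijLCA.rawDNL N (NijLCA.adjoint L) N)) ∧
    ∀ {M : Type*} [AddCommGroup M] [Module ℂ M] [Module NijLCA.DRing M]
      [IsScalarTower ℂ NijLCA.DRing M] (ρ : NijLCA.ConformalRep L M)
      (NM : M →ₗ[NijLCA.DRing] M), NijLCA.IsNijenhuisRep N ρ NM →
      NijLCA.FormsCochainComplex (NijLCA.nlCochains L M)
          (fun n => NijLCA.rawDNL N ρ NM (n + 1)) ∧
        NijLCA.FormsCochainComplex (NijLCA.nlCochainsFull L M) (NijLCA.rawDNL N ρ NM) := by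
  have hρ : NijLCA.IsNijenhuisRep N (NijLCA.adjoint L) N := hN
  exact ⟨⟨NijLCA.formsCochainComplex_nlCochains hN hρ,
      NijLCA.formsCochainComplex_nlCochainsFull hN hρ⟩,
    fun ρ NM h => ⟨NijLCA.formsCochainComplex_nlCochains hN h,
      NijLCA.formsCochainComplex_nlCochainsFull hN h⟩⟩
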